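/- Let $G$ be a (finite-dimensional) complex Lie group, $\Gamma\subset G$ a discrete subgroup with compact quotient, and let $M=\Gamma\backslash G$ be the resulting compact complex parallelizable manifold, with the complex structure for which the projection $\pi\colon G\to M$ is locally biholomorphic. Every left-invariant Hermitian metric on $G$ induces a unique Hermitian metric $g$ on $M$ whose pullback by $\pi$ is the given metric; call such metrics $g$ on $M$ left-invariant. For a Hermitian metric $g$ with complex structure $J$, let $F(X,Y)=g(JX,Y)$ be its Kähler form, $\delta$ the codifferential, $d^cF(A,B,C)=-dF(JA,JB,JC)$, and $D$ the Levi-Civita connection. The canonical Hermitian connections $\nabla^t$, $t\in\mathbb R$, are given by $$g(\nabla^t_AB,C)=g(D_AB,C)+\tfrac{t-1}{4}\,d^cF(A,B,C)+\tfrac{t+1}{4}\,d^cF(A,JB,JC).$$ With $R^t$ the curvature of $\nabla^t$, the Ricci form of $\nabla^t$ is $\rho^t(X,Y)=\sum_i g(R^t(X,Y)E_i,JE_i)$, where $(E_i)$ is a $g$-orthonormal frame. The metric $g$ is called balanced if $\delta F=0$, and CYT (Calabi–Yau with torsion) if the Ricci form $\rho^{-1}$ of the Bismut (KT) connection $\nabla^{-1}$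 vanishes. Theorem. Every left-invariant Hermitian metric $g$ on $M=\Gamma\backslash G$ is balanced and CYT. Moreover, the Ricci forms of all its canonical Hermitian connections vanish: $\rho^t=0$ for every $t\in\mathbb R$. -/

import Mathlib

open scoped Manifold ContDiff Topology

noncomputable section

/-! ### The complex manifold `Γ \ G` -/

/-- The quotient `Γ \ G`, i.e. the set of cosets `Γ a`, for a subgroup `Γ` of `G`. -/
def LeftQuotient {G : Type*} [Group G] (Γ : Subgroup G) : Type _ :=
  Quotient (QuotientGroup.rightRel Γ)

namespace LeftQuotient

/-- The projection `G → Γ \ G`. -/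
def proj {G : Type*} [Group G] (Γ : Subgroup G) (a : G) : LeftQuotient Γ :=
  Quotient.mk (QuotientGroup.rightRel Γ) a

theorem proj_eq_iff {G : Type*} [Group G] {Γ : Subgroup G} {a b : G} :
    proj Γ a = proj Γ b ↔ b * a⁻¹ ∈ Γ :=
  Quotient.eq''.trans QuotientGroup.rightRel_apply

/-- The quotient topology. -/
instance {G : Type*} [Group G] [TopologicalSpace G] (Γ : Subgroup G) :
    TopologicalSpace (LeftQuotient Γ) :=
  inferInstanceAs (TopologicalSpace (Quotient (QuotientGroup.rightRel Γ)))

theorem isLocalHomeomorph_proj {G : Type*} [Group G] [TopologicalSpace G] [IsTopologicalGroup G]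
    (Γ : Subgroup G) [DiscreteTopology Γ] : IsLocalHomeomorph (proj Γ) := by
  have h : Topology.IsQuotientMap (proj Γ) := isQuotientMap_quotient_mk'
  have h2 := h.isQuotientCoveringMap_of_subgroup Γ (isDiscrete_iff_discreteTopology.2 inferInstance)
    proj_eq_iff
  exact h2.isCoveringMap.isLocalHomeomorph

variable {E : Type*} [NormedAddCommGroup E] [NormedSpace ℂ E]
  {G : Type*} [Group G] [TopologicalSpace G] [ChartedSpace E G] [LieGroup 𝓘(ℂ, E) ω G]

variable (E) in
/-- The restriction of the projection `G → Γ \ G` to some open neighbourhood of `a`,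
on which it is a homeomorphism onto an open set. -/
def localProj (Γ : Subgroup G) [DiscreteTopology Γ] (a : G) :
    OpenPartialHomeomorph G (LeftQuotient Γ) :=
  haveI : IsTopologicalGroup G := topologicalGroup_of_lieGroup 𝓘(ℂ, E) ω
  (isLocalHomeomorph_proj Γ a).choose

theorem mem_localProj_source (Γ : Subgroup G) [DiscreteTopology Γ] (a : G) :
    a ∈ (localProj E Γ a).source :=
  haveI : IsTopologicalGroup G := topologicalGroup_of_lieGroup 𝓘(ℂ, E) ω
  (isLocalHomeomorph_proj Γ a).choose_spec.1

theorem coe_localProj (Γ : Subgroup G) [DiscreteTopology Γ] (a : G) :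
    ⇑(localProj E Γ a) = proj Γ :=
  haveI : IsTopologicalGroup G := topologicalGroup_of_lieGroup 𝓘(ℂ, E) ω
  (isLocalHomeomorph_proj Γ a).choose_spec.2.symm

/-- The charts of `Γ \ G` are the charts of `G` composed with local inverses of the projection. -/
instance chartedSpace (Γ : Subgroup G) [DiscreteTopology Γ] :
    ChartedSpace E (LeftQuotient Γ) where
  atlas := Set.range fun a : G => (localProj E Γ a).symm.trans (chartAt E a)
  chartAt x := (localProj E Γ (Quotient.out x)).symm.trans (chartAt E (Quotient.out x : G))
  mem_chart_source x := by
    have hx : proj Γ (Quotient.out x) = x := Quotient.out_eq x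
    have h1 := mem_localProj_source (E := E) Γ (Quotient.out x)
    have h2 := (localProj E Γ (Quotient.out x)).map_source h1
    have h3 := (localProj E Γ (Quotient.out x)).left_inv h1
    rw [coe_localProj, hx] at h2 h3
    simp only [OpenPartialHomeomorph.trans_source, OpenPartialHomeomorph.symm_source,
      Set.mem_inter_iff, Set.mem_preimage]
    refine ⟨h2, ?_⟩
    rw [h3]
    exact mem_chart_source E _
  chart_mem_atlas x := ⟨_, rfl⟩

/-- Local inverses of the projection differ locally by left translations. -/
theorem localProj_symm_eventuallyEq (Γ : Subgroup G) [DiscreteTopology Γ] (a p : G)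
    (hp : proj Γ p ∈ (localProj E Γ a).target) :
    ∃ γ : G, ∀ᶠ q in 𝓝 p, (localProj E Γ a).symm (proj Γ q) = γ * q := by
  have : IsTopologicalGroup G := topologicalGroup_of_lieGroup 𝓘(ℂ, E) ω
  set φ := localProj E Γ a with hφ
  have h1 : φ.symm (proj Γ p) ∈ φ.source := φ.map_target hp
  have h2 : proj Γ (φ.symm (proj Γ p)) = proj Γ p := by
    have := φ.right_inv hp
    rwa [hφ, coe_localProj, ← hφ] at this
  refine ⟨φ.symm (proj Γ p) * p⁻¹, ?_⟩
  have hc : Continuous fun q : G => φ.symm (proj Γ p) * p⁻¹ * q := by fun_prop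
  have h3 : ∀ᶠ q in 𝓝 p, φ.symm (proj Γ p) * p⁻¹ * q ∈ φ.source :=
    hc.continuousAt.eventually_mem (φ.open_source.mem_nhds (by simpa using h1))
  filter_upwards [h3] with q hq
  have h4 : proj Γ (φ.symm (proj Γ p) * p⁻¹ * q) = proj Γ q := by
    rw [eq_comm, proj_eq_iff]
    have := proj_eq_iff.1 h2.symm
    simpa [mul_assoc] using this
  have h5 := φ.left_inv hq
  rw [hφ, coe_localProj, ← hφ, h4] at h5
  exact h5

/-- `Γ \ G` is a complex manifold. -/
instance isManifold (Γ : Subgroup G) [DiscreteTopology Γ] :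
    IsManifold 𝓘(ℂ, E) ω (LeftQuotient Γ) := by
  apply isManifold_of_contDiffOn
  rintro _ _ ⟨a, rfl⟩ ⟨b, rfl⟩
  intro y hy
  apply ContDiffAt.contDiffWithinAt
  simp only [modelWithCornersSelf_coe, modelWithCornersSelf_coe_symm, Set.preimage_id,
    Set.range_id, Set.inter_univ, coe_localProj, mfld_simps] at hy ⊢
  obtain ⟨⟨hy1, -⟩, hy2, hy3⟩ := hy
  obtain ⟨γ, hγ⟩ := localProj_symm_eventuallyEq Γ b _ hy2
  have hs : ContMDiffAt 𝓘(ℂ, E) 𝓘(ℂ, E) ω (chartAt E a).symm y :=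
    (contMDiffOn_chart_symm (I := 𝓘(ℂ, E)) (x := a)).contMDiffAt
      ((chartAt E a).open_target.mem_nhds hy1)
  have hq := hγ.self_of_nhds
  have hm : ContMDiffAt 𝓘(ℂ, E) 𝓘(ℂ, E) ω (fun z => γ * (chartAt E a).symm z) y :=
    contMDiffAt_const.mul hs
  have hc : ContMDiffAt 𝓘(ℂ, E) 𝓘(ℂ, E) ω (chartAt E b) (γ * (chartAt E a).symm y) :=
    (contMDiffOn_chart (I := 𝓘(ℂ, E)) (x := b)).contMDiffAt
      ((chartAt E b).open_source.mem_nhds (by rw [← hq]; exact hy3))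
  refine (ContMDiffAt.comp y hc hm).contDiffAt.congr_of_eventuallyEq ?_
  filter_upwards [hs.continuousAt.eventually hγ] with z hz
  simp only [Function.comp_apply, hz]

/-- The projection `G → Γ \ G` is locally biholomorphic. -/
theorem isLocalDiffeomorph_proj (Γ : Subgroup G) [DiscreteTopology Γ] :
    IsLocalDiffeomorph 𝓘(ℂ, E) 𝓘(ℂ, E) ω (proj Γ) := by
  have key (o p : G) (hp : proj Γ p ∈ (localProj E Γ o).target) :
      ContMDiffAt 𝓘(ℂ, E) 𝓘(ℂ, E) ω (fun q => (localProj E Γ o).symm (proj Γ q)) p := by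
    obtain ⟨γ, hγ⟩ := localProj_symm_eventuallyEq Γ o p hp
    exact (contMDiffAt_const.mul contMDiffAt_id).congr_of_eventuallyEq hγ
  intro a
  refine ⟨⟨(localProj E Γ a).toPartialEquiv, (localProj E Γ a).open_source,
    (localProj E Γ a).open_target, ?_, ?_⟩, mem_localProj_source Γ a, ?_⟩
  · intro p _
    change ContMDiffWithinAt _ _ _ (localProj E Γ a) _ p
    rw [coe_localProj]
    apply ContMDiffAt.contMDiffWithinAt
    have hx := mem_chart_source E (proj Γ p)
    set c := chartAt E (proj Γ p) with hc
    have hx' := hx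
    change _ ∈ ((localProj E Γ (Quotient.out (proj Γ p))).symm.trans
      (chartAt E (Quotient.out (proj Γ p) : G))).source at hx'
    simp only [mfld_simps] at hx'
    have h1 := key _ p hx'.1
    have h2 : ContMDiffAt 𝓘(ℂ, E) 𝓘(ℂ, E) ω (fun q => c (proj Γ q)) p :=
      ContMDiffAt.comp p (g := chartAt E (Quotient.out (proj Γ p) : G))
        (f := fun q => (localProj E Γ (Quotient.out (proj Γ p))).symm (proj Γ q))
        ((contMDiffOn_chart (I := 𝓘(ℂ, E))
        (x := (Quotient.out (proj Γ p) : G))).contMDiffAt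
          ((chartAt E _).open_source.mem_nhds hx'.2)) h1
    have h3 : ContMDiffAt 𝓘(ℂ, E) 𝓘(ℂ, E) ω c.symm (c (proj Γ p)) :=
      (contMDiffOn_chart_symm (I := 𝓘(ℂ, E)) (x := proj Γ p)).contMDiffAt
        (c.open_target.mem_nhds (c.map_source hx))
    refine (ContMDiffAt.comp p h3 h2).congr_of_eventuallyEq ?_
    have hcont : Continuous (proj Γ) := continuous_quot_mk
    filter_upwards [hcont.continuousAt.eventually_mem (c.open_source.mem_nhds hx)] with q hq
    exact (c.left_inv hq).symm
  · intro x hx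
    apply ContMDiffAt.contMDiffWithinAt
    change ContMDiffAt _ _ _ (localProj E Γ a).symm x
    have hxc := mem_chart_source E x
    set o : G := Quotient.out x with ho
    have hx' := hxc
    change _ ∈ ((localProj E Γ o).symm.trans (chartAt E o)).source at hx'
    simp only [mfld_simps] at hx'
    set c := chartAt E x with hc
    have hpo : proj Γ o = x := Quotient.out_eq x
    have hoo : (localProj E Γ o).symm x = o := by
      have := (localProj E Γ o).left_inv (mem_localProj_source Γ o)
      rwa [coe_localProj, hpo] at this
    have h1 := key a o (by rw [hpo]; exact hx)
    have hc1 : ContMDiffAt 𝓘(ℂ, E) 𝓘(ℂ, E) ω c x :=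
      (contMDiffOn_chart (I := 𝓘(ℂ, E)) (x := x)).contMDiffAt (c.open_source.mem_nhds hxc)
    have hcx : c x = chartAt E o o := by
      change chartAt E o ((localProj E Γ o).symm x) = _
      rw [hoo]
    have h2 : ContMDiffAt 𝓘(ℂ, E) 𝓘(ℂ, E) ω (chartAt E o).symm (c x) :=
      (contMDiffOn_chart_symm (I := 𝓘(ℂ, E)) (x := o)).contMDiffAt
        ((chartAt E o).open_target.mem_nhds (by
          rw [hcx]; exact (chartAt E o).map_source (mem_chart_source E o)))
    have h3 : ContMDiffAt 𝓘(ℂ, E) 𝓘(ℂ, E) ω (fun z => (chartAt E o).symm (c z)) x :=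
      ContMDiffAt.comp x h2 hc1
    have h4 : ContMDiffAt 𝓘(ℂ, E) 𝓘(ℂ, E) ω
        (fun z => (localProj E Γ a).symm (proj Γ ((chartAt E o).symm (c z)))) x := by
      refine ContMDiffAt.comp x (f := fun z => (chartAt E o).symm (c z))
        (g := fun q => (localProj E Γ a).symm (proj Γ q)) ?_ h3
      have : (chartAt E o).symm (c x) = o := by
        rw [hcx]; exact (chartAt E o).left_inv (mem_chart_source E o)
      rw [this]
      exact h1
    refine h4.congr_of_eventuallyEq ?_
    filter_upwards [c.open_source.mem_nhds hxc] with z hz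
    congr 1
    change z ∈ ((localProj E Γ o).symm.trans (chartAt E o)).source at hz
    simp only [mfld_simps] at hz
    have : (chartAt E o).symm (c z) = (localProj E Γ o).symm z :=
      (chartAt E o).left_inv hz.2
    rw [this]
    have h6 := (localProj E Γ o).right_inv hz.1
    rw [coe_localProj] at h6
    exact h6.symm
  · intro q _
    change _ = localProj E Γ a q
    rw [coe_localProj]

end LeftQuotient

/-! ### Hermitian geometry on an open subset of a complex vector space

Here `g` is a Hermitian metric on an open set of `E` (a field of real bilinear forms), `J` is
multiplication by the imaginary unit, and vector fields are functions `E → E`. -/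

namespace Hermitian

variable {E : Type*} [NormedAddCommGroup E] [NormedSpace ℂ E]

variable (E) in
/-- The complex structure of `E`. -/
def J : E →L[ℝ] E := (Complex.I • ContinuousLinearMap.id ℂ E).restrictScalars ℝ

/-- The Kähler form `F(A, B) = g(J A, B)`. -/
def kahlerForm (g : E → E →L[ℝ] E →L[ℝ] ℝ) (y : E) : E →L[ℝ] E →L[ℝ] ℝ :=
  (g y).comp (J E)

/-- The exterior derivative `dF(A, B, C) = A F(B, C) + B F(C, A) + C F(A, B)` (for constant
`A`, `B`, `C`) of the Kähler form, as a linear form in `C`. -/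
def dKahler (g : E → E →L[ℝ] E →L[ℝ] ℝ) (y A B : E) : E →L[ℝ] ℝ :=
  fderiv ℝ (kahlerForm g) y A B + (fderiv ℝ (kahlerForm g) y B).flip A +
    ((fderiv ℝ (kahlerForm g) y).flip A).flip B

/-- `d^c F = J d F`, where `J` acts on `n`-forms by `(J α)(X₁, …) = (-1)ⁿ α(J X₁, …)`, so that
`d^c F(A, B, C) = - dF(J A, J B, J C)`; as a linear form in `C`. -/
def dcKahler (g : E → E →L[ℝ] E →L[ℝ] ℝ) (y A B : E) : E →L[ℝ] ℝ :=
  -(dKahler g y (J E A) (J E B)).comp (J E)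

/-- The vector that represents a linear form with respect to `g y`. -/
def sharp (g : E → E →L[ℝ] E →L[ℝ] ℝ) (y : E) : (E →L[ℝ] ℝ) →L[ℝ] E :=
  ContinuousLinearMap.inverse (g y)

/-- The Levi-Civita connection `D_A B = dB(A) + Γ(A, B)`, with Christoffel symbols given by
`2 g(Γ(A, B), C) = A g(B, C) + B g(A, C) - C g(A, B)` (for constant `A`, `B`, `C`). -/
def leviCivita (g : E → E →L[ℝ] E →L[ℝ] ℝ) (A B : E → E) (y : E) : E :=
  fderiv ℝ B y (A y) + sharp g y ((1 / 2 : ℝ) •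
    (fderiv ℝ g y (A y) (B y) + fderiv ℝ g y (B y) (A y)
      - ((fderiv ℝ g y).flip (A y)).flip (B y)))

/-- The canonical connection `∇ᵗ`:
`g(∇ᵗ_A B, C) = g(D_A B, C) + (t-1)/4 d^c F(A, B, C) + (t+1)/4 d^c F(A, J B, J C)`. -/
def canonicalConnection (g : E → E →L[ℝ] E →L[ℝ] ℝ) (t : ℝ) (A B : E → E) (y : E) : E :=
  leviCivita g A B y + sharp g y
    (((t - 1) / 4) • dcKahler g y (A y) (B y) +
      ((t + 1) / 4) • (dcKahler g y (A y) (J E (B y))).comp (J E))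

/-- The curvature `Rᵗ(A, B) C = ∇ᵗ_A ∇ᵗ_B C - ∇ᵗ_B ∇ᵗ_A C - ∇ᵗ_[A, B] C`. -/
def curvature (g : E → E →L[ℝ] E →L[ℝ] ℝ) (t : ℝ) (A B C : E → E) (y : E) : E :=
  canonicalConnection g t A (canonicalConnection g t B C) y
    - canonicalConnection g t B (canonicalConnection g t A C) y
    - canonicalConnection g t (VectorField.lieBracket ℝ A B) C y

/-- `b` is a basis of `E` that is orthonormal for `g y`. -/
def IsOrthonormalAt (g : E → E →L[ℝ] E →L[ℝ] ℝ) (y : E)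
    (b : Module.Basis (Fin (Module.finrank ℝ E)) ℝ E) : Prop :=
  ∀ i j, g y (b i) (b j) = if i = j then 1 else 0

/-- The Ricci form `ρᵗ(X, Y) = ∑ᵢ g(Rᵗ(X, Y) Eᵢ, J Eᵢ)` of `∇ᵗ` at `y`, computed in the
orthonormal basis `b = (Eᵢ)`. -/
def ricciForm (g : E → E →L[ℝ] E →L[ℝ] ℝ) (t : ℝ) (y : E)
    (b : Module.Basis (Fin (Module.finrank ℝ E)) ℝ E) (X Y : E) : ℝ :=
  ∑ i, g y (curvature g t (fun _ => X) (fun _ => Y) (fun _ => b i) y) (J E (b i))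

/-- The covariant derivative `(D_X F)(A, B) = X F(A, B) - F(D_X A, B) - F(A, D_X B)` of the
Kähler form at `y`. -/
def covKahler (g : E → E →L[ℝ] E →L[ℝ] ℝ) (y X A B : E) : ℝ :=
  fderiv ℝ (kahlerForm g) y X A B
    - kahlerForm g y (leviCivita g (fun _ => X) (fun _ => A) y) B
    - kahlerForm g y A (leviCivita g (fun _ => X) (fun _ => B) y)

/-- The codifferential `δF(Y) = - ∑ᵢ (D_{Eᵢ} F)(Eᵢ, Y)` of the Kähler form at `y`, computed in
the orthonormal basis `b = (Eᵢ)`. -/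
def codiffKahler (g : E → E →L[ℝ] E →L[ℝ] ℝ) (y : E)
    (b : Module.Basis (Fin (Module.finrank ℝ E)) ℝ E) (Y : E) : ℝ :=
  -∑ i, covKahler g y (b i) (b i) Y

end Hermitian

/-! ### Hermitian metrics on complex manifolds -/

section Metric

variable (E : Type*) [NormedAddCommGroup E] [NormedSpace ℂ E]
  {M : Type*} [TopologicalSpace M] [ChartedSpace E M]

/-- The pullback `(u, v) ↦ h(df u, df v)` of a bilinear form `h` on the tangent space at `f x`
under the differential of `f` at `x`. (`TangentSpace 𝓘(ℂ, E) x` is by definition `E`, whose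
elements represent tangent vectors at `x` through the chart `chartAt E x`.) -/
def pullbackForm {N : Type*} [TopologicalSpace N] [ChartedSpace E N] (f : N → M) (x : N)
    (h : E →L[ℝ] E →L[ℝ] ℝ) : E →L[ℝ] E →L[ℝ] ℝ :=
  h.bilinearComp
    ((mfderiv 𝓘(ℂ, E) 𝓘(ℂ, E) f x : E →L[ℂ] E).restrictScalars ℝ)
    ((mfderiv 𝓘(ℂ, E) 𝓘(ℂ, E) f x : E →L[ℂ] E).restrictScalars ℝ)

variable (M) in
/-- A (smooth) Hermitian metric on a complex manifold `M` modelled on `E`: a smooth Riemannian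
metric that is invariant under the complex structure of the tangent spaces. The form `inner x`
lives on the tangent space `TangentSpace 𝓘(ℂ, E) x = E`; its complex structure is that of `E`,
as the charts are holomorphic. Smoothness means that the coefficients in every holomorphic
chart are smooth. -/
@[ext]
structure HermitianMetric where
  /-- The bilinear form on each tangent space. -/
  inner (x : M) : E →L[ℝ] E →L[ℝ] ℝ
  symm (x : M) (u v : E) : inner x u v = inner x v u
  pos (x : M) (u : E) (hu : u ≠ 0) : 0 < inner x u u
  hermitian (x : M) (u v : E) : inner x (Hermitian.J E u) (Hermitian.J E v) = inner x u v
  smooth (e : OpenPartialHomeomorph M E) (he : e ∈ IsManifold.maximalAtlas 𝓘(ℂ, E) ω M) :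
    ContDiffOn ℝ ∞ (fun y : E => pullbackForm E e.symm y (inner (e.symm y))) e.target

end Metric

namespace HermitianMetric

variable {E : Type*} [NormedAddCommGroup E] [NormedSpace ℂ E]
  {M : Type*} [TopologicalSpace M] [ChartedSpace E M]

/-- The expression of a Hermitian metric in a chart `e`, a field of bilinear forms on
`e.target`. -/
def inChart (h : HermitianMetric E M) (e : OpenPartialHomeomorph M E) (y : E) :
    E →L[ℝ] E →L[ℝ] ℝ :=
  pullbackForm E e.symm y (h.inner (e.symm y))

/-- The Ricci form `ρᵗ` of the canonical connection `∇ᵗ` vanishes identically on `M`. -/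
def RicciFormVanishes (h : HermitianMetric E M) (t : ℝ) : Prop :=
  ∀ e ∈ IsManifold.maximalAtlas 𝓘(ℂ, E) ω M, ∀ y ∈ e.target,
    ∀ b, Hermitian.IsOrthonormalAt (h.inChart e) y b →
      ∀ X Y : E, Hermitian.ricciForm (h.inChart e) t y b X Y = 0

/-- Calabi-Yau with torsion: the Ricci form of the KT (Bismut) connection `∇⁻¹` vanishes. -/
def IsCYT (h : HermitianMetric E M) : Prop :=
  h.RicciFormVanishes (-1)

/-- Balanced: `δF = 0`. -/
def IsBalanced (h : HermitianMetric E M) : Prop :=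
  ∀ e ∈ IsManifold.maximalAtlas 𝓘(ℂ, E) ω M, ∀ y ∈ e.target,
    ∀ b, Hermitian.IsOrthonormalAt (h.inChart e) y b →
      ∀ Y : E, Hermitian.codiffKahler (h.inChart e) y b Y = 0

/-- All left translations `b ↦ a * b` of the group are isometries. -/
def IsLeftInvariant {G : Type*} [Group G] [TopologicalSpace G] [ChartedSpace E G]
    (g : HermitianMetric E G) : Prop :=
  ∀ a b : G, pullbackForm E (fun c : G => a * c) b (g.inner (a * b)) = g.inner b

/-- `h` is the metric on `Γ \ G` induced by the metric `g` on `G`, i.e. the pullback of `h` under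
the projection `G → Γ \ G` is `g`. -/
def IsInducedBy {G : Type*} [Group G] [TopologicalSpace G] [ChartedSpace E G]
    [LieGroup 𝓘(ℂ, E) ω G] {Γ : Subgroup G} [DiscreteTopology Γ]
    (h : HermitianMetric E (LeftQuotient Γ)) (g : HermitianMetric E G) : Prop :=
  ∀ a : G, pullbackForm E (LeftQuotient.proj Γ) a (h.inner (LeftQuotient.proj Γ a)) = g.inner a

end HermitianMetric

end

/-! Everything is computed in the left-invariant coframe. Let `P` be the Maurer-Cartan form of `G`
in a chart and `β` the Lie bracket; `G` is a complex Lie group, so `β` is complex bilinear. A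
left-invariant metric is the pullback of one Hermitian form `g₀` by `P`, and `dP(A, B) = -β(P A, P
B)`.

The complex bilinearity of `β` makes the torsion terms collapse: in this coframe `∇ᵗ` is the flat
connection plus `(t - 1) S`, where `S a = (ad_a^* - ad_a) / 2`. At `t = 1` this is the connection
for which left-invariant fields are parallel. The curvature is therefore `(t - 1)² [S X, S Y] - (t -
1) S [X, Y]`, and `ρᵗ(X, Y)` is minus the trace of `J` composed with it (`map_curvature`). As `S u`
commutes with `J`, the commutator term has trace zero; the other term reduces to `tr(J S u) = -tr
ad_{J u}`. Likewise `δF(Y) = -tr ad_{J Y}` for the left-invariant value of `Y`. Hence all the claims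
follow from unimodularity: `tr ad_u = 0` for all `u` (`codiffKahler_eq_zero`, `ricciForm_eq_zero`).

Unimodularity comes from the cocompact discrete subgroup. Right translates of a compact set of
representatives have bounded Haar measure, so the modular character is bounded and thus trivial
(`modularCharacterFun_eq_one`). Haar measure is then annihilated both by the left-invariant fields
and by the right-invariant ones. Expanding a right-invariant field in the left-invariant frame and
integrating by parts shows that its coefficients have zero divergence, which at the identity is the
trace of `ad` (`trace_lieBracketCLM_eq_zero`).

Finally, every chart of the quotient lifts locally to a chart of `G`, so these local computations
apply to the induced metric. -/

noncomputable section

/-- A map into a space of linear maps with finite-dimensional domain is smooth at a point as soon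
as its evaluations at all vectors are. -/
theorem contDiffAt_clm_apply_iff {𝕜 : Type*} [NontriviallyNormedField 𝕜] [CompleteSpace 𝕜]
    {D E F : Type*} [NormedAddCommGroup D] [NormedSpace 𝕜 D] [NormedAddCommGroup E]
    [NormedSpace 𝕜 E] [FiniteDimensional 𝕜 E] [NormedAddCommGroup F] [NormedSpace 𝕜 F]
    {n : WithTop ℕ∞} {f : D → E →L[𝕜] F} {x : D} :
    ContDiffAt 𝕜 n f x ↔ ∀ v, ContDiffAt 𝕜 n (fun y => f y v) x := by
  refine ⟨fun h v => h.clm_apply contDiffAt_const, fun h => ?_⟩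
  let d := Module.finrank 𝕜 E
  have hd : d = Module.finrank 𝕜 (Fin d → 𝕜) := (Module.finrank_fin_fun 𝕜).symm
  let e₁ := ContinuousLinearEquiv.ofFinrankEq hd
  let e₂ := (e₁.arrowCongr (1 : F ≃L[𝕜] F)).trans (ContinuousLinearEquiv.piRing (Fin d))
  rw [← Function.id_comp f, ← e₂.symm_comp_self]
  exact e₂.symm.contDiff.contDiffAt.comp x (contDiffAt_pi.mpr fun i => h _)

/-! ### Linear algebra of Hermitian forms. -/

namespace Hermitian

variable {E : Type*} [NormedAddCommGroup E] [NormedSpace ℂ E]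

@[simp]
theorem J_apply (u : E) : J E u = Complex.I • u := rfl

/-- The trace of an endomorphism computed in an orthonormal basis. -/
theorem trace_eq_sum_of_orthonormal {g₀ : E →L[ℝ] E →L[ℝ] ℝ} {ι : Type*} [Fintype ι]
    [DecidableEq ι] (b : Module.Basis ι ℝ E)
    (hb : ∀ i j, g₀ (b i) (b j) = if i = j then 1 else 0) (T : E →ₗ[ℝ] E) :
    LinearMap.trace ℝ E T = ∑ i, g₀ (T (b i)) (b i) := by
  rw [LinearMap.trace_eq_matrix_trace ℝ b, Matrix.trace]
  refine Finset.sum_congr rfl fun i _ => ?_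
  rw [Matrix.diag_apply, LinearMap.toMatrix_apply]
  have h1 : g₀ (∑ j, b.repr (T (b i)) j • b j) (b i) = b.repr (T (b i)) i := by
    simp only [map_sum, sum_apply, map_smul, smul_apply, hb]
    simp
  rw [← h1, b.sum_repr]

/-- A Hermitian inner product on `E`, given by its real part. -/
structure IsHermitianForm (g₀ : E →L[ℝ] E →L[ℝ] ℝ) : Prop where
  symm (u v : E) : g₀ u v = g₀ v u
  pos (u : E) (hu : u ≠ 0) : 0 < g₀ u u
  hermitian (u v : E) : g₀ (J E u) (J E v) = g₀ u v

namespace IsHermitianForm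

variable {g₀ : E →L[ℝ] E →L[ℝ] ℝ} (h : IsHermitianForm g₀)

include h

theorem J_left (u v : E) : g₀ (J E u) v = -g₀ u (J E v) := by
  have h1 := h.hermitian u (J E v)
  have h2 : J E (J E v) = -v := by simp [smul_smul]
  rw [h2, map_neg] at h1
  linarith

theorem ext_left {u v : E} (huv : ∀ w, g₀ u w = g₀ v w) : u = v := by
  by_contra hne
  have h1 := h.pos (u - v) (sub_ne_zero.2 hne)
  rw [ContinuousLinearMap.map_sub₂, huv, sub_self] at h1
  exact lt_irrefl _ h1

variable [FiniteDimensional ℝ E]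

theorem isInvertible : g₀.IsInvertible := by
  have hinj : Function.Injective g₀.toLinearMap := fun u v huv =>
    h.ext_left fun w => congrArg (fun l : E →L[ℝ] ℝ => l w) huv
  have hfr : Module.finrank ℝ E = Module.finrank ℝ (E →L[ℝ] ℝ) := by
    rw [← LinearEquiv.finrank_eq (LinearMap.toContinuousLinearMap (E := E) (F' := ℝ))]
    exact (Subspace.dual_finrank_eq (K := ℝ) (V := E)).symm
  let e := LinearEquiv.ofInjectiveOfFinrankEq g₀.toLinearMap hinj hfr
  exact ⟨e.toContinuousLinearEquiv, by ext; rfl⟩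

theorem apply_inverse (l : E →L[ℝ] ℝ) : g₀ (ContinuousLinearMap.inverse g₀ l) = l := by
  obtain ⟨e, he⟩ := h.isInvertible
  rw [← he, ContinuousLinearMap.inverse_equiv]
  exact e.apply_symm_apply l

/-- The skew part `(a, b) ↦ (ad_a^* b - ad_a b) / 2` of a bilinear product. -/
theorem exists_skewPart (β : E →L[ℝ] E →L[ℝ] E) : ∃ S : E →L[ℝ] E →L[ℝ] E,
    ∀ a b c, g₀ (S a b) c = (1 / 2 : ℝ) * (g₀ (β a c) b - g₀ (β a b) c) := by
  -- The adjoint is `ad_a^* b = g₀⁻¹(g₀(b, ad_a ·))`; nondegeneracy of `g₀` supplies the inverse.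
  let S₁ : E →ₗ[ℝ] E →L[ℝ] E :=
    { toFun := fun a => (1 / 2 : ℝ) • ((ContinuousLinearMap.inverse g₀).comp
        (((ContinuousLinearMap.compL ℝ E E ℝ).flip (β a)).comp g₀) - β a)
      map_add' := fun a a' => by ext b; simp [ContinuousLinearMap.comp_add, sub_eq_add_neg]; module
      map_smul' := fun r a => by ext b; simp [smul_sub]; module }
  refine ⟨LinearMap.toContinuousLinearMap S₁, fun a b c => ?_⟩
  have h1 := DFunLike.congr_fun
    (h.apply_inverse ((((ContinuousLinearMap.compL ℝ E E ℝ).flip (β a)).comp g₀) b)) c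
  simp only [ContinuousLinearMap.coe_comp, Function.comp_apply, ContinuousLinearMap.flip_apply,
    ContinuousLinearMap.compL_apply] at h1
  have h2 : S₁ a b = (1 / 2 : ℝ) • (ContinuousLinearMap.inverse g₀ ((g₀ b).comp (β a)) - β a b) :=
    rfl
  rw [LinearMap.coe_toContinuousLinearMap', h2]
  simp only [map_smul, map_sub, smul_apply, sub_apply, h1,
    smul_eq_mul, h.symm b]

end IsHermitianForm

/-! ### Metrics given by a Maurer-Cartan coframe, and their canonical connections. -/

/-- Near `y`, the metric `g` is the pullback of the constant form `g₀` under a coframe `P` that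
satisfies the Maurer-Cartan equation `dP(A, B) = -β(P A, P B)`. -/
structure IsMaurerCartanAt (g : E → E →L[ℝ] E →L[ℝ] ℝ) (g₀ : E →L[ℝ] E →L[ℝ] ℝ)
    (β : E →L[ℝ] E →L[ℝ] E) (P : E → E →L[ℝ] E) (y : E) : Prop where
  contDiffAt : ContDiffAt ℝ 2 P y
  isInvertible : (P y).IsInvertible
  map_J : ∀ᶠ z in 𝓝 y, ∀ u, P z (J E u) = J E (P z u)
  metric : ∀ᶠ z in 𝓝 y, ∀ u v, g z u v = g₀ (P z u) (P z v)
  maurerCartan (A B : E) : fderiv ℝ P y A B - fderiv ℝ P y B A = -β (P y A) (P y B)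

section Local

variable {g : E → E →L[ℝ] E →L[ℝ] ℝ} {g₀ : E →L[ℝ] E →L[ℝ] ℝ} {β S : E →L[ℝ] E →L[ℝ] E}
  {P : E → E →L[ℝ] E} {y : E}

theorem IsHermitianForm.comp {Q : E →L[ℝ] E} {f : E →L[ℝ] E →L[ℝ] ℝ} (h₀ : IsHermitianForm g₀)
    (hQ : Q.IsInvertible) (hJ : ∀ u, Q (J E u) = J E (Q u))
    (hf : ∀ u v, f u v = g₀ (Q u) (Q v)) : IsHermitianForm f where
  symm u v := by rw [hf, hf, h₀.symm]
  pos u hu := by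
    rw [hf]
    exact h₀.pos _ fun h => hu (hQ.injective (by rw [h, map_zero]))
  hermitian u v := by rw [hf, hf, hJ, hJ, h₀.hermitian]

namespace IsMaurerCartanAt

variable (h : IsMaurerCartanAt g g₀ β P y)

include h

theorem differentiableAt : DifferentiableAt ℝ P y := h.contDiffAt.differentiableAt (by norm_num)

theorem isHermitianForm (h₀ : IsHermitianForm g₀) : IsHermitianForm (g y) :=
  h₀.comp h.isInvertible h.map_J.self_of_nhds h.metric.self_of_nhds

theorem hasFDerivAt_apply (B : E) :
    HasFDerivAt (fun z => P z B) ((fderiv ℝ P y).flip B) y := by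
  simpa using h.differentiableAt.hasFDerivAt.clm_apply (hasFDerivAt_const B y)

theorem fderiv_map_J (A B : E) : fderiv ℝ P y A (J E B) = J E (fderiv ℝ P y A B) := by
  have h1 := h.hasFDerivAt_apply (J E B)
  have h2 := (J E).hasFDerivAt.comp y (h.hasFDerivAt_apply B)
  have h3 : (fun z => P z (J E B)) =ᶠ[𝓝 y] (J E) ∘ fun z => P z B := by
    filter_upwards [h.map_J] with z hz
    simp only [hz, Function.comp_apply]
  exact DFunLike.congr_fun (h1.unique (h2.congr_of_eventuallyEq h3)) A

variable [FiniteDimensional ℝ E]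

theorem differentiableAt_metric : DifferentiableAt ℝ g y := by
  have h2 : ContDiffAt ℝ 1 g y := by
    rw [contDiffAt_clm_apply_iff]
    intro u
    rw [contDiffAt_clm_apply_iff]
    intro v
    have hP := h.contDiffAt.of_le (m := 1) (by norm_num)
    have h3 : ContDiffAt ℝ 1 (fun z => g₀ (P z u) (P z v)) y :=
      (g₀.contDiff.contDiffAt.comp y (hP.clm_apply contDiffAt_const)).clm_apply
        (hP.clm_apply contDiffAt_const)
    refine h3.congr_of_eventuallyEq ?_
    filter_upwards [h.metric] with z hz using hz u v
  exact h2.differentiableAt (by norm_num)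

theorem fderiv_metric (A B C : E) : fderiv ℝ g y A B C =
    g₀ (fderiv ℝ P y A B) (P y C) + g₀ (P y B) (fderiv ℝ P y A C) := by
  have h1 := ((h.differentiableAt_metric.hasFDerivAt.clm_apply
    (hasFDerivAt_const B y)).clm_apply (hasFDerivAt_const C y))
  have h2 := (g₀.hasFDerivAt.comp y (h.hasFDerivAt_apply B)).clm_apply (h.hasFDerivAt_apply C)
  have h3 : (fun z => g z B C) =ᶠ[𝓝 y] fun z => (g₀ ∘ fun z => P z B) z (P z C) := by
    filter_upwards [h.metric] with z hz using hz B C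
  have h4 := DFunLike.congr_fun (h1.unique (h2.congr_of_eventuallyEq h3)) A
  simp at h4
  linarith

theorem fderiv_kahlerForm (A B C : E) : fderiv ℝ (kahlerForm g) y A B C =
    g₀ (J E (fderiv ℝ P y A B)) (P y C) + g₀ (J E (P y B)) (fderiv ℝ P y A C) := by
  have h1 := h.differentiableAt_metric.hasFDerivAt.clm_comp (hasFDerivAt_const (J E) y)
  have h2 : fderiv ℝ (kahlerForm g) y A B C = fderiv ℝ g y A (J E B) C := by
    have h3 : HasFDerivAt (kahlerForm g) _ y := h1
    rw [h3.fderiv]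
    simp
  rw [h2, ← h.fderiv_map_J, ← h.map_J.self_of_nhds]
  exact h.fderiv_metric A (J E B) C

/-- The six first-order terms of `dF` pair up by skewness of `g₀(J ·, ·)`. Each pair contains the
antisymmetrised derivative of `P`, which the Maurer-Cartan equation turns into `β`. -/
theorem dKahler_eq (h₀ : IsHermitianForm g₀) (A B C : E) : dKahler g y A B C =
    -(g₀ (J E (β (P y A) (P y B))) (P y C) + g₀ (J E (β (P y B) (P y C))) (P y A)
      + g₀ (J E (β (P y C) (P y A))) (P y B)) := by
  have key (A B C : E) : g₀ (J E (fderiv ℝ P y A B)) (P y C)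
      + g₀ (J E (P y C)) (fderiv ℝ P y B A) = -g₀ (J E (β (P y A) (P y B))) (P y C) := by
    rw [h₀.J_left (P y C), h₀.symm (P y C), ← sub_eq_add_neg, ← sub_apply,
      ← map_sub, ← map_sub, h.maurerCartan, map_neg, map_neg, neg_apply]
  have h1 := key A B C
  have h2 := key B C A
  have h3 := key C A B
  simp only [dKahler, add_apply, ContinuousLinearMap.flip_apply,
    h.fderiv_kahlerForm]
  linarith

/-- Complex bilinearity lets every `J` be pulled out of `β`, where it cancels against the invariance
of `g₀`. What remains is minus the cyclic sum of `g₀(β(A, B), C)`. -/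
theorem dcKahler_eq (h₀ : IsHermitianForm g₀)
    (hβl : ∀ u v, β (J E u) v = J E (β u v)) (hβr : ∀ u v, β u (J E v) = J E (β u v))
    (A B C : E) : dcKahler g y A B C =
    -(g₀ (β (P y A) (P y B)) (P y C) + g₀ (β (P y B) (P y C)) (P y A)
      + g₀ (β (P y C) (P y A)) (P y B)) := by
  have hJJ (u : E) : J E (J E u) = -u := by simp [smul_smul]
  have hJ := h.map_J.self_of_nhds
  simp only [dcKahler, neg_apply, ContinuousLinearMap.coe_comp,
    Function.comp_apply, h.dKahler_eq h₀, hJ, hβl, hβr, hJJ, map_neg,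
    h₀.hermitian]
  ring

/-- Koszul's formula for the coframe: the derivative part is the derivative of `P B` along `A`, and
the three bracket terms come from the Maurer-Cartan equation. -/
theorem leviCivita_eq (h₀ : IsHermitianForm g₀) (A B : E → E) (C : E) :
    g₀ (P y (leviCivita g A B y)) (P y C) =
      g₀ (P y (fderiv ℝ B y (A y)) + fderiv ℝ P y (A y) (B y)) (P y C) + (1 / 2 : ℝ) *
      (g₀ (β (P y (A y)) (P y (B y))) (P y C) - g₀ (P y (B y)) (β (P y (A y)) (P y C))
        - g₀ (P y (A y)) (β (P y (B y)) (P y C))) := by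
  have hg := h.isHermitianForm h₀
  have h1 := DFunLike.congr_fun (hg.apply_inverse ((1 / 2 : ℝ) •
    (fderiv ℝ g y (A y) (B y) + fderiv ℝ g y (B y) (A y)
      - ((fderiv ℝ g y).flip (A y)).flip (B y)))) C
  rw [h.metric.self_of_nhds] at h1
  have key (u A B : E) : g₀ u (fderiv ℝ P y A B) - g₀ u (fderiv ℝ P y B A) =
      -g₀ u (β (P y A) (P y B)) := by
    rw [← map_sub, h.maurerCartan, map_neg]
  have h3 := key (P y (B y)) (A y) C
  have h4 := key (P y (A y)) (B y) C
  have h5 := key (P y C) (A y) (B y)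
  simp only [leviCivita, sharp, map_add, add_apply, h1]
  simp only [smul_apply, add_apply,
    sub_apply, ContinuousLinearMap.flip_apply, h.fderiv_metric, smul_eq_mul]
  rw [h₀.symm _ (P y C), h₀.symm _ (P y C), h₀.symm _ (P y C), h₀.symm _ (P y C),
    h₀.symm _ (P y (B y))] at *
  linarith

/-- The connection `∇ᵗ` in the coframe `P`. -/
theorem map_canonicalConnection (h₀ : IsHermitianForm g₀)
    (hβl : ∀ u v, β (J E u) v = J E (β u v)) (hβr : ∀ u v, β u (J E v) = J E (β u v))
    (hβ : ∀ u v, β u v = -β v u)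
    (hS : ∀ a b c, g₀ (S a b) c = (1 / 2 : ℝ) * (g₀ (β a c) b - g₀ (β a b) c))
    (t : ℝ) (A B : E → E) :
    P y (canonicalConnection g t A B y) = P y (fderiv ℝ B y (A y)) + fderiv ℝ P y (A y) (B y)
      + (t - 1) • S (P y (A y)) (P y (B y)) := by
  have hJ := h.map_J.self_of_nhds
  have hg := h.isHermitianForm h₀
  refine h₀.ext_left fun w => ?_
  obtain ⟨C, rfl⟩ := h.isInvertible.surjective w
  have h1 := DFunLike.congr_fun (hg.apply_inverse (((t - 1) / 4) • dcKahler g y (A y) (B y) +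
      ((t + 1) / 4) • (dcKahler g y (A y) (J E (B y))).comp (J E))) C
  rw [h.metric.self_of_nhds] at h1
  rw [canonicalConnection, sharp, map_add (P y), map_add g₀, add_apply, h1, h.leviCivita_eq h₀]
  simp only [map_add, add_apply, map_smul, smul_apply, smul_eq_mul, hS,
    ContinuousLinearMap.coe_comp, Function.comp_apply, h.dcKahler_eq h₀ hβl hβr, hJ, hβl, hβr,
    h₀.hermitian]
  have hJJ (u : E) : J E (J E u) = -u := by simp [smul_smul]
  -- Replacing `B, C` by `J B, J C` changes the sign of the term `g₀(β(B, C), A)` only. With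
  -- coefficients `(t - 1)/4` and `(t + 1)/4` this term cancels against Levi-Civita, and the two
  -- others combine to `(t - 1) S`.
  rw [hβ (P y C) (P y (A y)), hJJ, h₀.symm (P y (B y)), h₀.symm (P y (A y))]
  simp only [map_neg, neg_apply]
  ring

end IsMaurerCartanAt

end Local

end Hermitian

end

/-! ### Codifferential, curvature and Ricci form as traces of the bracket. -/

noncomputable section

namespace Hermitian

variable {E : Type*} [NormedAddCommGroup E] [NormedSpace ℂ E] [FiniteDimensional ℝ E]
  {g : E → E →L[ℝ] E →L[ℝ] ℝ} {g₀ : E →L[ℝ] E →L[ℝ] ℝ} {β S : E →L[ℝ] E →L[ℝ] E}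
  {P : E → E →L[ℝ] E} {y : E}

omit [FiniteDimensional ℝ E] in
/-- An invertible coframe maps orthonormal bases to orthonormal bases. -/
theorem IsMaurerCartanAt.exists_orthonormal (h : IsMaurerCartanAt g g₀ β P y)
    {b : Module.Basis (Fin (Module.finrank ℝ E)) ℝ E} (hb : IsOrthonormalAt g y b) :
    ∃ c : Module.Basis (Fin (Module.finrank ℝ E)) ℝ E,
      (∀ i, P y (b i) = c i) ∧ ∀ i j, g₀ (c i) (c j) = if i = j then 1 else 0 := by
  obtain ⟨e, he⟩ := h.isInvertible
  have hc (i) : P y (b i) = (b.map e.toLinearEquiv) i := by rw [← he]; simp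
  refine ⟨b.map e.toLinearEquiv, hc, fun i j => ?_⟩
  rw [← hc, ← hc, ← h.metric.self_of_nhds]
  exact hb i j

/-- `δF = 0` if the product `β` is unimodular. -/
theorem IsMaurerCartanAt.codiffKahler_eq_zero (h : IsMaurerCartanAt g g₀ β P y)
    (h₀ : IsHermitianForm g₀)
    (hβl : ∀ u v, β (J E u) v = J E (β u v)) (hβr : ∀ u v, β u (J E v) = J E (β u v))
    (hβ : ∀ u v, β u v = -β v u)
    (htr : ∀ u, LinearMap.trace ℝ E (β u).toLinearMap = 0)
    {b : Module.Basis (Fin (Module.finrank ℝ E)) ℝ E} (hb : IsOrthonormalAt g y b) (Y : E) :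
    codiffKahler g y b Y = 0 := by
  obtain ⟨c, hc, hcc⟩ := h.exists_orthonormal hb
  have hJ := h.map_J.self_of_nhds
  have hββ (u : E) : β u u = 0 := by
    have h1 : (2 : ℝ) • β u u = 0 := by rw [two_smul]; nth_rewrite 1 [hβ]; exact neg_add_cancel _
    simpa using h1
  -- The derivatives of `P` cancel, and what is left is a diagonal entry of `ad_{J Y}`. Summation
  -- gives its trace.
  have key (i) : covKahler g y (b i) (b i) Y = g₀ (β (J E (P y Y)) (c i)) (c i) := by
    have h1 := h.leviCivita_eq h₀ (fun _ => b i) (fun _ => b i) (J E Y)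
    have h2 := h.leviCivita_eq h₀ (fun _ => b i) (fun _ => Y) (J E (b i))
    simp only [fderiv_fun_const, Pi.zero_apply, zero_apply, map_zero, zero_add, hJ, hc, hβr,
      hββ] at h1 h2
    simp only [covKahler, kahlerForm, ContinuousLinearMap.coe_comp, Function.comp_apply,
      h.fderiv_kahlerForm, h.metric.self_of_nhds, hJ, hc]
    rw [h₀.J_left (P y _) (P y Y), h1, h₀.symm (J E (c i)) (P y _), h2, hβ (c i) (P y Y),
      h₀.J_left _ (P y Y), h₀.symm (J E (c i)) (fderiv ℝ P y (b i) Y), hβl]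
    simp only [map_neg, neg_apply]
    have h3 := h₀.J_left (β (P y Y) (c i)) (c i)
    rw [h₀.symm (c i) (J E _)]
    linarith
  rw [codiffKahler, Finset.sum_congr rfl fun i _ => key i, neg_eq_zero,
    ← htr (J E (P y Y)), trace_eq_sum_of_orthonormal c hcc]
  rfl

/-- The curvature of `∇ᵗ` in the coframe `P`. -/
theorem map_curvature (h : ∀ᶠ z in 𝓝 y, IsMaurerCartanAt g g₀ β P z)
    (h₀ : IsHermitianForm g₀)
    (hβl : ∀ u v, β (J E u) v = J E (β u v)) (hβr : ∀ u v, β u (J E v) = J E (β u v))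
    (hβ : ∀ u v, β u v = -β v u)
    (hS : ∀ a b c, g₀ (S a b) c = (1 / 2 : ℝ) * (g₀ (β a c) b - g₀ (β a b) c))
    (t : ℝ) (X Y C : E) :
    P y (curvature g t (fun _ => X) (fun _ => Y) (fun _ => C) y) =
      (t - 1) ^ 2 • (S (P y X) (S (P y Y) (P y C)) - S (P y Y) (S (P y X) (P y C)))
        - (t - 1) • S (β (P y X) (P y Y)) (P y C) := by
  have hy := h.self_of_nhds
  set s := t - 1 with hs
  -- The expression of `∇ᵗ_Y C` in the coframe, for constant `Y` and `C`.
  let Q (Y z : E) : E := fderiv ℝ P z Y C + s • S (P z Y) (P z C)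
  have hQ (Y : E) : ∀ᶠ z in 𝓝 y,
      P z (canonicalConnection g t (fun _ => Y) (fun _ => C) z) = Q Y z := by
    filter_upwards [h] with z hz
    rw [hz.map_canonicalConnection h₀ hβl hβr hβ hS]
    simp [Q, hs]
  have hP2 : DifferentiableAt ℝ (fderiv ℝ P) y :=
    (hy.contDiffAt.fderiv_right (m := 1) (by norm_num)).differentiableAt (by norm_num)
  have hQd (Y : E) : HasFDerivAt (Q Y) (((fderiv ℝ (fderiv ℝ P) y).flip Y).flip C +
      s • ((S (P y Y)).comp ((fderiv ℝ P y).flip C) +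
        (S.comp ((fderiv ℝ P y).flip Y)).flip (P y C))) y := by
    have h1 := (hP2.hasFDerivAt.clm_apply (hasFDerivAt_const Y y)).clm_apply
      (hasFDerivAt_const C y)
    have h2 := (S.hasFDerivAt.comp y (hy.hasFDerivAt_apply Y)).clm_apply (hy.hasFDerivAt_apply C)
    refine HasFDerivAt.congr_fderiv (f := Q Y) (h1.add (h2.const_smul s)) ?_
    ext v
    simp
  -- The second covariant derivative differentiates `∇ᵗ_Y C` itself, so its differentiability is
  -- needed; it is recovered from `Q Y` by applying the inverse of `P`.
  have hV (Y : E) : ∃ V' : E →L[ℝ] E, HasFDerivAt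
      (canonicalConnection g t (fun _ => Y) (fun _ => C)) V' y := by
    have h1 : ContDiffAt ℝ 1 (fun z => ContinuousLinearMap.inverse (P z)) y := by
      obtain ⟨e, he⟩ := hy.isInvertible
      have h2 : ContDiffAt ℝ 1 (ContinuousLinearMap.inverse : (E →L[ℝ] E) → E →L[ℝ] E) (P y) := by
        rw [← he]; exact contDiffAt_map_inverse e
      exact h2.comp y (hy.contDiffAt.of_le (by norm_num))
    have h3 : DifferentiableAt ℝ (fun z => ContinuousLinearMap.inverse (P z) (Q Y z)) y :=
      (h1.differentiableAt (by norm_num)).clm_apply (hQd Y).differentiableAt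
    refine ⟨_, (h3.congr_of_eventuallyEq ?_).hasFDerivAt⟩
    filter_upwards [h, hQ Y] with z hz hz'
    obtain ⟨e, he⟩ := hz.isInvertible
    rw [← hz', ← he, ContinuousLinearMap.inverse_equiv]
    exact (e.symm_apply_apply _).symm
  have key (X Y : E) : P y (canonicalConnection g t (fun _ => X)
      (canonicalConnection g t (fun _ => Y) (fun _ => C)) y) =
      fderiv ℝ (fderiv ℝ P) y X Y C + s • (S (P y Y) (fderiv ℝ P y X C) +
        S (fderiv ℝ P y X Y) (P y C)) + s • S (P y X) (Q Y y) := by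
    obtain ⟨V', hV'⟩ := hV Y
    have h1 := hy.differentiableAt.hasFDerivAt.clm_apply hV'
    have h2 := DFunLike.congr_fun (h1.unique ((hQd Y).congr_of_eventuallyEq (hQ Y))) X
    simp only [add_apply, smul_apply, ContinuousLinearMap.coe_comp, Function.comp_apply,
      ContinuousLinearMap.flip_apply] at h2
    rw [hy.map_canonicalConnection h₀ hβl hβr hβ hS, hV'.fderiv, (hQ Y).self_of_nhds, ← hs, h2]
  -- Antisymmetrising in `X, Y` removes the second derivatives of `P`. The surviving first-order
  -- term is the antisymmetrised derivative inside `S`, which equals `-β(P X, P Y)`.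
  have hsymm : fderiv ℝ (fderiv ℝ P) y X Y = fderiv ℝ (fderiv ℝ P) y Y X :=
    (hy.contDiffAt.isSymmSndFDerivAt (by simp)).eq X Y
  have hzero : P y (canonicalConnection g t (VectorField.lieBracket ℝ (fun _ => X) (fun _ => Y))
      (fun _ => C) y) = 0 := by
    rw [hy.map_canonicalConnection h₀ hβl hβr hβ hS]
    simp [VectorField.lieBracket]
  have hmc : fderiv ℝ P y X Y = fderiv ℝ P y Y X - β (P y X) (P y Y) := by
    rw [sub_eq_add_neg, ← hy.maurerCartan]; abel
  rw [curvature, map_sub, map_sub, key, key, hzero, hsymm, hmc]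
  simp only [Q, map_add, map_sub, map_smul, sub_apply]
  module

/-- `ρᵗ = 0` if the product `β` is unimodular. -/
theorem ricciForm_eq_zero (h : ∀ᶠ z in 𝓝 y, IsMaurerCartanAt g g₀ β P z)
    (h₀ : IsHermitianForm g₀)
    (hβl : ∀ u v, β (J E u) v = J E (β u v)) (hβr : ∀ u v, β u (J E v) = J E (β u v))
    (hβ : ∀ u v, β u v = -β v u)
    (htr : ∀ u, LinearMap.trace ℝ E (β u).toLinearMap = 0) (t : ℝ)
    {b : Module.Basis (Fin (Module.finrank ℝ E)) ℝ E} (hb : IsOrthonormalAt g y b) (X Y : E) :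
    ricciForm g t y b X Y = 0 := by
  obtain ⟨S, hS⟩ := h₀.exists_skewPart β
  have hy := h.self_of_nhds
  have hJ := hy.map_J.self_of_nhds
  obtain ⟨c, hc, hcc⟩ := hy.exists_orthonormal hb
  have hSJ (u v : E) : S u (J E v) = J E (S u v) := by
    refine h₀.ext_left fun w => ?_
    rw [hS, h₀.J_left, hS, hβr, hβr, h₀.J_left (β u v), ← neg_eq_iff_eq_neg.2 (h₀.J_left (β u w) v)]
    ring
  let 𝒮 (u : E) : E →ₗ[ℝ] E := (S u).toLinearMap
  let 𝒥 : E →ₗ[ℝ] E := (J E).toLinearMap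
  have h𝒮𝒥 (u : E) : 𝒮 u * 𝒥 = 𝒥 * 𝒮 u := by ext v; exact hSJ u v
  have hcomm (u v : E) : LinearMap.trace ℝ E (𝒥 * (𝒮 u * 𝒮 v - 𝒮 v * 𝒮 u)) = 0 := by
    rw [mul_sub, map_sub, ← mul_assoc 𝒥 (𝒮 u), LinearMap.trace_mul_comm ℝ (𝒥 * 𝒮 u), ← mul_assoc,
      h𝒮𝒥, mul_assoc, sub_self]
  -- The two halves `ad_u^*` and `-ad_u` of `2 S u` contribute equally to the trace of `J S u`,
  -- giving `-tr(J ad_u) = -tr ad_{J u}`.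
  have hskew (u : E) : LinearMap.trace ℝ E (𝒥 * 𝒮 u) = 0 := by
    rw [trace_eq_sum_of_orthonormal c hcc]
    have h1 (i) : g₀ ((𝒥 * 𝒮 u) (c i)) (c i) = -g₀ (β (J E u) (c i)) (c i) := by
      change g₀ (J E (S u (c i))) (c i) = _
      rw [h₀.J_left, hS, hβr, hβl, h₀.J_left (β u (c i))]
      ring
    rw [Finset.sum_congr rfl fun i _ => h1 i, Finset.sum_neg_distrib, neg_eq_zero,
      ← htr (J E u), trace_eq_sum_of_orthonormal c hcc]
    rfl
  let T : E →ₗ[ℝ] E := (t - 1) ^ 2 • (𝒥 * (𝒮 (P y X) * 𝒮 (P y Y) - 𝒮 (P y Y) * 𝒮 (P y X)))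
    - (t - 1) • (𝒥 * 𝒮 (β (P y X) (P y Y)))
  have hT : LinearMap.trace ℝ E T = 0 := by simp only [T, map_sub, map_smul, hcomm, hskew]; simp
  -- Since `J` is skew, `g(R e, J e) = -g(J R e, e)`, so the Ricci form is minus the trace of `T`.
  rw [ricciForm, ← neg_eq_zero, ← Finset.sum_neg_distrib, ← hT,
    trace_eq_sum_of_orthonormal c hcc]
  refine Finset.sum_congr rfl fun i _ => ?_
  rw [hy.metric.self_of_nhds, map_curvature h h₀ hβl hβr hβ hS, hJ, hc, ← h₀.J_left]
  congr 2
  simp [T, 𝒥, 𝒮, smul_sub, -J_apply]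

end Hermitian

end

/-! ### A locally compact group with a cocompact discrete subgroup is unimodular. -/

noncomputable section

open MeasureTheory Measure

namespace LeftQuotient

variable {G : Type*} [Group G] [TopologicalSpace G] [IsTopologicalGroup G]

/-- A cocompact discrete subgroup of a locally compact group has a compact set of
representatives. -/
theorem exists_isCompact_forall_exists_mul_mem [LocallyCompactSpace G] (Γ : Subgroup G)
    [DiscreteTopology Γ] [CompactSpace (LeftQuotient Γ)] :
    ∃ K : Set G, IsCompact K ∧ (interior K).Nonempty ∧ ∀ x, ∃ γ : Γ, (γ : G) * x ∈ K := by
  have hopen : IsOpenMap (proj Γ) := (isLocalHomeomorph_proj Γ).isOpenMap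
  choose K hKc hK using fun a : G => exists_compact_mem_nhds a
  obtain ⟨t, ht⟩ := isCompact_univ.elim_finite_subcover (fun a : G => proj Γ '' interior (K a))
    (fun a => hopen _ isOpen_interior) (fun x _ => by
      obtain ⟨a, rfl⟩ := Quotient.exists_rep x
      exact Set.mem_iUnion.2 ⟨a, a, mem_interior_iff_mem_nhds.2 (hK a), rfl⟩)
  have hsub : ⋃ a ∈ t, interior (K a) ⊆ interior (⋃ a ∈ t, K a) :=
    interior_maximal (Set.iUnion₂_mono fun a _ => interior_subset)
      (isOpen_biUnion fun a _ => isOpen_interior)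
  have hx (x : LeftQuotient Γ) : ∃ y ∈ ⋃ a ∈ t, interior (K a), proj Γ y = x := by
    obtain ⟨a, ha, y, hy, hyx⟩ := Set.mem_iUnion₂.1 (ht (Set.mem_univ x))
    exact ⟨y, Set.mem_biUnion ha hy, hyx⟩
  refine ⟨⋃ a ∈ t, K a, t.isCompact_biUnion fun a _ => hKc a, ?_, fun x => ?_⟩
  · obtain ⟨y, hy, -⟩ := hx (proj Γ 1)
    exact ⟨y, hsub hy⟩
  · obtain ⟨y, hy, hyx⟩ := hx (proj Γ x)
    refine ⟨⟨y * x⁻¹, proj_eq_iff.1 hyx.symm⟩, ?_⟩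
    simpa using interior_subset (hsub hy)

theorem finite_setOf_coe_mem [T2Space G] (Γ : Subgroup G) [DiscreteTopology Γ] {C : Set G}
    (hC : IsCompact C) : {γ : Γ | (γ : G) ∈ C}.Finite := by
  have h1 := (Γ.tendsto_coe_cofinite_of_discrete
    (isDiscrete_iff_discreteTopology.2 inferInstance)).eventually hC.compl_mem_cocompact
  simpa [Filter.eventually_cofinite] using h1

/-- The measures of the right translates of a compact set of representatives are bounded. -/
theorem exists_forall_measure_preimage_mul_right_le [T2Space G] [MeasurableSpace G] [BorelSpace G]
    (μ : Measure G) [IsMulLeftInvariant μ] (Γ : Subgroup G) [DiscreteTopology Γ]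
    {K : Set G} (hK : IsCompact K) (hΓK : ∀ x, ∃ γ : Γ, (γ : G) * x ∈ K) :
    ∃ N : ℕ, ∀ a : G, μ ((· * a) ⁻¹' K) ≤ N * μ K := by
  classical
  -- `N` counts the elements of `Γ` in `K K⁻¹`. It bounds how many translates `γ A` meet at one
  -- point, independently of `a`.
  have hD := finite_setOf_coe_mem Γ (hK.mul hK.inv)
  refine ⟨hD.toFinset.card, fun a => ?_⟩
  set A : Set G := (· * a) ⁻¹' K with hA
  have hAc : IsCompact A := (Homeomorph.mulRight a).isCompact_preimage.2 hK
  have hF := finite_setOf_coe_mem Γ (hK.mul hAc.inv)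
  set F := hF.toFinset with hFdef
  -- `A = K a⁻¹` is cut into pieces that elements of `Γ` move into `K`; left translation preserves
  -- their measures.
  have hcover : A ⊆ ⋃ γ ∈ F, (fun x => (γ : G) * x) ⁻¹' (((γ : G)⁻¹ * ·) ⁻¹' A ∩ K) := by
    intro x hx
    obtain ⟨γ, hγ⟩ := hΓK x
    refine Set.mem_iUnion₂.2 ⟨γ, ?_, by simpa using hx, hγ⟩
    rw [hFdef, Set.Finite.mem_toFinset]
    exact ⟨γ * x, hγ, x⁻¹, Set.inv_mem_inv.2 hx, by simp⟩
  have hmeas (γ : G) : MeasurableSet ((γ⁻¹ * ·) ⁻¹' A) :=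
    ((Homeomorph.mulLeft γ⁻¹).isCompact_preimage.2 hAc).measurableSet
  calc μ A ≤ ∑ γ ∈ F, μ ((fun x => (γ : G) * x) ⁻¹' (((γ : G)⁻¹ * ·) ⁻¹' A ∩ K)) :=
        (measure_mono hcover).trans (measure_biUnion_finset_le _ _)
    _ = ∑ γ ∈ F, ∫⁻ x in K, (((γ : G)⁻¹ * ·) ⁻¹' A).indicator 1 x ∂μ := by
        refine Finset.sum_congr rfl fun γ _ => ?_
        rw [measure_preimage_mul, lintegral_indicator_one (hmeas γ), restrict_apply (hmeas γ)]
    _ = ∫⁻ x in K, ∑ γ ∈ F, (((γ : G)⁻¹ * ·) ⁻¹' A).indicator 1 x ∂μ :=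
        (lintegral_finsetSum F fun (γ : Γ) _ => measurable_one.indicator (hmeas (γ : G))).symm
    _ ≤ ∫⁻ _ in K, (hD.toFinset.card : ENNReal) ∂μ := by
        refine lintegral_mono fun x => ?_
        simp only [Set.indicator_apply, Pi.one_apply, Finset.sum_boole]
        rw [Nat.cast_le]
        rcases (F.filter fun γ : Γ => x ∈ ((γ : G)⁻¹ * ·) ⁻¹' A).eq_empty_or_nonempty
          with h | ⟨δ, hδ⟩
        · exact (congrArg Finset.card h).trans_le (Nat.zero_le _)
        -- If `x` lies in both `γ A` and `δ A`, then `γ⁻¹ x a` and `δ⁻¹ x a` lie in `K`, so `γ⁻¹ δ`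
        -- lies in `K K⁻¹`.
        refine Finset.card_le_card_of_injOn (fun γ : Γ => γ⁻¹ * δ) ?_
          fun γ _ γ' _ h => by simpa using h
        intro γ hγ
        simp only [Finset.coe_filter, Set.mem_ofPred_eq, Finset.mem_filter, hA,
          Set.mem_preimage] at hγ hδ
        simp only [Set.Finite.coe_toFinset, Set.mem_ofPred_eq]
        exact ⟨_, hγ.2, _, Set.inv_mem_inv.2 hδ.2, by simp [mul_assoc]⟩
    _ = hD.toFinset.card * μ K := by simp

/-- A locally compact group with a cocompact discrete subgroup is unimodular. -/
theorem modularCharacterFun_eq_one [LocallyCompactSpace G] [T2Space G] (Γ : Subgroup G)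
    [DiscreteTopology Γ] [CompactSpace (LeftQuotient Γ)] (a : G) : modularCharacterFun a = 1 := by
  borelize G
  obtain ⟨K, hK, hKi, hΓK⟩ := exists_isCompact_forall_exists_mul_mem Γ
  obtain ⟨N, hN⟩ := exists_forall_measure_preimage_mul_right_le haar Γ hK hΓK
  have hpos : haar K ≠ 0 := (measure_pos_of_nonempty_interior _ hKi).ne'
  have hle (b : G) : modularCharacterFun b ≤ N := by
    have h1 : map (· * b) haar K = modularCharacterFun b • haar K := by
      rw [modularCharacterFun_eq_haarScalarFactor haar]
      exact measure_isMulInvariant_eq_smul_of_isCompact_closure _ _ hK.closure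
    rw [map_apply (measurable_mul_const b) hK.measurableSet] at h1
    have h2 := hN b
    rw [h1, ENNReal.smul_def, smul_eq_mul,
      ENNReal.mul_le_mul_iff_left hpos hK.measure_lt_top.ne] at h2
    exact_mod_cast h2
  -- A bounded homomorphism to the positive reals cannot exceed `1`, since its powers would be
  -- unbounded. Applied to the inverse, this forces equality.
  have hle_one (b : G) : modularCharacterFun b ≤ 1 := by
    by_contra! h
    obtain ⟨n, hn⟩ := pow_unbounded_of_one_lt (N : NNReal) h
    have h1 := hle (b ^ n)
    change modularCharacter (b ^ n) ≤ _ at h1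
    rw [map_pow] at h1
    exact absurd hn (not_lt.2 h1)
  refine le_antisymm (hle_one a) ?_
  have h1 := modularCharacterFun_map_mul a a⁻¹
  rw [mul_inv_cancel, modularCharacterFun_map_one] at h1
  rw [h1]
  exact mul_le_of_le_one_right zero_le (hle_one _)

/-- On a locally compact group with a cocompact discrete subgroup, Haar integrals are right
invariant. -/
theorem integral_mul_right_eq_self [LocallyCompactSpace G] [T2Space G] [MeasurableSpace G]
    [BorelSpace G] (μ : Measure G) [IsHaarMeasure μ] (Γ : Subgroup G) [DiscreteTopology Γ]
    [CompactSpace (LeftQuotient Γ)] {f : G → ℝ} (hf : Continuous f) (hfc : HasCompactSupport f)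
    (a : G) : ∫ x, f (x * a) ∂μ = ∫ x, f x ∂μ := by
  have h1 := integral_isMulLeftInvariant_eq_smul_of_hasCompactSupport (map (· * a) μ) μ hf hfc
  rw [← modularCharacterFun_eq_haarScalarFactor, modularCharacterFun_eq_one Γ, one_smul,] at h1
  rw [← h1]
  exact ((MeasurableEquiv.mulRight a).measurableEmbedding.integral_map f).symm

end LeftQuotient

end

/-! ### Infinitesimal invariance of measures and divergence. -/

noncomputable section

open MeasureTheory Measure

section Infinitesimal

variable {E : Type*} [NormedAddCommGroup E] [NormedSpace ℝ E] [FiniteDimensional ℝ E]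

/-- Infinitesimal invariance: a measure that is invariant under a family of maps `T s`, given in
the chart `φ` by `N (·, s)`, is annihilated by the vector field `∂N/∂s` at `s = 0`. -/
theorem integral_fderiv_eq_zero_of_integral_comp_eq {X : Type*} [TopologicalSpace X] [T2Space X]
    [MeasurableSpace X] [BorelSpace X] (μ : Measure X) [IsFiniteMeasureOnCompacts μ]
    (φ : OpenPartialHomeomorph X E) (T : ℝ → X → X) (N : E × ℝ → E) {x₀ : E} {r ρ δ : ℝ}
    (hδ : 0 < δ) (hrρ : r ≤ ρ) (hρ : Metric.closedBall x₀ ρ ⊆ φ.target)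
    (hN : ∀ p ∈ Metric.closedBall x₀ ρ ×ˢ Metric.closedBall (0 : ℝ) δ, ContDiffAt ℝ 1 N p)
    (hTN : ∀ s ∈ Metric.closedBall (0 : ℝ) δ, ∀ x ∈ φ.source, φ x ∈ Metric.closedBall x₀ ρ →
      T s x ∈ φ.source ∧ φ (T s x) = N (φ x, s))
    (hT : ∀ s ∈ Metric.closedBall (0 : ℝ) δ, ∀ x, T s x ∈ φ.source →
      φ (T s x) ∈ Metric.closedBall x₀ r → x ∈ φ.source ∧ φ x ∈ Metric.closedBall x₀ ρ)
    (hN0 : ∀ y ∈ Metric.closedBall x₀ ρ, N (y, 0) = y)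
    (hinv : ∀ f : X → ℝ, Continuous f → HasCompactSupport f → ∀ s,
      ∫ x, f (T s x) ∂μ = ∫ x, f x ∂μ)
    (F : E → ℝ) (hF : ContDiff ℝ 1 F) (hFr : ∀ y ∉ Metric.closedBall x₀ r, F y = 0) :
    ∫ x in φ.source ∩ φ ⁻¹' Metric.closedBall x₀ ρ,
      fderiv ℝ F (φ x) (fderiv ℝ N (φ x, 0) (0, 1)) ∂μ = 0 := by
  set S := φ.source ∩ φ ⁻¹' Metric.closedBall x₀ ρ with hS
  have hcompact (R : ℝ) (hR : R ≤ ρ) : IsCompact (φ.source ∩ φ ⁻¹' Metric.closedBall x₀ R) := by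
    have hsub := (Metric.closedBall_subset_closedBall hR).trans hρ
    rw [← φ.symm_image_eq_source_inter_preimage hsub]
    exact (isCompact_closedBall x₀ R).image_of_continuousOn (φ.continuousOn_symm.mono hsub)
  have hSc : IsCompact S := hcompact ρ le_rfl
  have hSm : MeasurableSet S := hSc.measurableSet
  have hφS : ContinuousOn φ S := φ.continuousOn.mono Set.inter_subset_left
  let f : X → ℝ := φ.source.indicator (F ∘ φ)
  have hf0 (x : X) (hx : x ∉ φ.source ∩ φ ⁻¹' Metric.closedBall x₀ r) : f x = 0 := by
    by_cases hxs : x ∈ φ.source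
    · exact (Set.indicator_of_mem hxs _).trans (hFr _ fun h => hx ⟨hxs, h⟩)
    · exact Set.indicator_of_notMem hxs _
  have hfts : tsupport f ⊆ φ.source ∩ φ ⁻¹' Metric.closedBall x₀ r :=
    closure_minimal (fun x hx => by_contra fun h => hx (hf0 x h)) (hcompact r hrρ).isClosed
  have hfc : HasCompactSupport f := (hcompact r hrρ).of_isClosed_subset (isClosed_tsupport f) hfts
  have hfcont : Continuous f := by
    refine continuous_of_tsupport fun x hx => ?_
    have hxs := (hfts hx).1
    refine ((hF.continuous.continuousAt.comp (φ.continuousAt hxs))).congr ?_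
    filter_upwards [φ.open_source.mem_nhds hxs] with z hz
    exact (Set.indicator_of_mem hz _).symm
  -- If `T s` moves `x` into the support of `f`, then `x` already lies in `S`. The integral thus
  -- lives on a fixed compact set and can be differentiated in `s` there.
  have hfT (s : ℝ) (hs : s ∈ Metric.closedBall (0 : ℝ) δ) :
      ∫ x, f (T s x) ∂μ = ∫ x in S, F (N (φ x, s)) ∂μ := by
    rw [← integral_indicator hSm]
    congr 1
    ext x
    by_cases hx : x ∈ S
    · obtain ⟨h1, h2⟩ := hTN s hs x hx.1 hx.2
      rw [Set.indicator_of_mem hx, ← h2]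
      exact Set.indicator_of_mem h1 _
    · rw [Set.indicator_of_notMem hx]
      exact hf0 _ fun h => hx (hT s hs x h.1 h.2)
  let D : E × ℝ → ℝ := fun p => fderiv ℝ F (N p) (fderiv ℝ N p (0, 1))
  have hD : ContinuousOn D (Metric.closedBall x₀ ρ ×ˢ Metric.closedBall (0 : ℝ) δ) := by
    intro p hp
    have hNp := hN p hp
    have h1 : ContinuousAt (fun p => fderiv ℝ F (N p)) p :=
      ((hF.continuous_fderiv (by norm_num)).continuousAt).comp hNp.continuousAt
    have h2 : ContinuousAt (fun p => fderiv ℝ N p (0, 1)) p :=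
      (hNp.continuousAt_fderiv (by norm_num)).clm_apply continuousAt_const
    exact (h1.clm_apply h2).continuousWithinAt
  obtain ⟨C, hC⟩ := ((isCompact_closedBall x₀ ρ).prod
    (isCompact_closedBall (0 : ℝ) δ)).exists_bound_of_continuousOn hD
  have hpair (s : ℝ) (hs : s ∈ Metric.closedBall (0 : ℝ) δ) :
      Set.MapsTo (fun x => (φ x, s)) S (Metric.closedBall x₀ ρ ×ˢ Metric.closedBall (0 : ℝ) δ) :=
    fun x hx => ⟨hx.2, hs⟩
  have hcontS (s : ℝ) (hs : s ∈ Metric.closedBall (0 : ℝ) δ) :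
      ContinuousOn (fun x => F (N (φ x, s))) S := by
    refine hF.continuous.comp_continuousOn (ContinuousOn.comp (g := N) (f := fun x => (φ x, s))
      (fun p hp => (hN p hp).continuousAt.continuousWithinAt) ?_ (hpair s hs))
    exact hφS.prodMk continuousOn_const
  have h0 : (0 : ℝ) ∈ Metric.closedBall (0 : ℝ) δ := Metric.mem_closedBall_self hδ.le
  have : IsFiniteMeasure (μ.restrict S) := ⟨by
    rw [Measure.restrict_apply MeasurableSet.univ, Set.univ_inter]; exact hSc.measure_lt_top⟩
  have hderiv := (hasDerivAt_integral_of_dominated_loc_of_deriv_le (μ := μ.restrict S)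
    (F := fun s x => F (N (φ x, s))) (F' := fun s x => D (φ x, s)) (x₀ := (0 : ℝ))
    (bound := fun _ => C) (s := Metric.closedBall (0 : ℝ) δ) (Metric.closedBall_mem_nhds _ hδ)
    (by
      filter_upwards [Metric.closedBall_mem_nhds (0 : ℝ) hδ] with s hs
      exact (hcontS s hs).aestronglyMeasurable hSm)
    ((hcontS 0 h0).integrableOn_compact hSc)
    ((hD.comp (hφS.prodMk continuousOn_const) (hpair 0 h0)).aestronglyMeasurable hSm)
    (by
      filter_upwards [ae_restrict_mem hSm] with x hx s hs
      exact hC _ ⟨hx.2, hs⟩)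
    (integrable_const C)
    (by
      filter_upwards [ae_restrict_mem hSm] with x hx s hs
      have h1 : HasDerivAt (fun s : ℝ => (φ x, s)) ((0 : E), (1 : ℝ)) s :=
        (hasDerivAt_const s (φ x)).prodMk (hasDerivAt_id s)
      have h2 : HasDerivAt (fun s : ℝ => N (φ x, s)) (fderiv ℝ N (φ x, s) (0, 1)) s :=
        ((hN (φ x, s) ⟨hx.2, hs⟩).differentiableAt (by norm_num)).hasFDerivAt.comp_hasDerivAt s h1
      exact ((hF.differentiable (by norm_num)) _).hasFDerivAt.comp_hasDerivAt s h2)).2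
  have hconst : (fun s => ∫ x in S, F (N (φ x, s)) ∂μ) =ᶠ[𝓝 0] fun _ => ∫ x, f x ∂μ := by
    filter_upwards [Metric.closedBall_mem_nhds (0 : ℝ) hδ] with s hs
    rw [← hfT s hs, hinv f hfcont hfc]
  have hzero := hderiv.unique ((hasDerivAt_const (0 : ℝ) _).congr_of_eventuallyEq hconst)
  refine Eq.trans ?_ hzero
  refine setIntegral_congr_fun hSm fun x hx => ?_
  simp only [D, hN0 _ hx.2]

/-- Integration by parts: if a measure is annihilated by a frame `Z` and by a field `Y`, then `Y`
is divergence free with respect to the frame. -/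
theorem trace_eq_zero_of_integral_fderiv_eq_zero [MeasurableSpace E] [BorelSpace E]
    (ν : Measure E) [IsFiniteMeasure ν] {x₀ : E} (hν : ∀ U ∈ 𝓝 x₀, ν U ≠ 0)
    {Z : E → E →L[ℝ] E} {Y : E → E} (hZ : ContDiffAt ℝ 1 Z x₀) (hY : ContDiffAt ℝ 1 Y x₀)
    (hZ0 : Z x₀ = ContinuousLinearMap.id ℝ E) {r : ℝ} (hr : 0 < r)
    (hZint : ∀ w, ∀ F : E → ℝ, ContDiff ℝ 1 F → (∀ y ∉ Metric.closedBall x₀ r, F y = 0) →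
      ∫ y, fderiv ℝ F y (Z y w) ∂ν = 0)
    (hYint : ∀ F : E → ℝ, ContDiff ℝ 1 F → (∀ y ∉ Metric.closedBall x₀ r, F y = 0) →
      ∫ y, fderiv ℝ F y (Y y) ∂ν = 0) :
    LinearMap.trace ℝ E (fderiv ℝ Y x₀ - (fderiv ℝ Z x₀).flip (Y x₀)).toLinearMap = 0 := by
  classical
  -- `a` is the coefficient vector of `Y` in the frame `Z`, and `τ` is its divergence along the
  -- frame. No density of `ν` with respect to Lebesgue measure is needed.
  let a : E → E := fun y => (Z y).inverse (Y y)
  let τ : E → ℝ := fun y => LinearMap.trace ℝ E ((fderiv ℝ a y).comp (Z y)).toLinearMap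
  have ha : ContDiffAt ℝ 1 a x₀ := by
    have h1 : ContDiffAt ℝ 1 (ContinuousLinearMap.inverse : (E →L[ℝ] E) → E →L[ℝ] E) (Z x₀) := by
      rw [hZ0]; exact contDiffAt_map_inverse (ContinuousLinearEquiv.refl ℝ E)
    exact (h1.comp x₀ hZ).clm_apply hY
  have hinv : ∀ᶠ y in 𝓝 x₀, Z y (a y) = Y y := by
    have h1 : ∀ᶠ y in 𝓝 x₀, Z y ∈ Set.range ((↑) : (E ≃L[ℝ] E) → E →L[ℝ] E) :=
      hZ.continuousAt.eventually_mem (by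
        rw [hZ0]; exact ContinuousLinearEquiv.nhds (ContinuousLinearEquiv.refl ℝ E))
    filter_upwards [h1] with y hy
    obtain ⟨e, he⟩ := hy
    simp only [a, ← he, ContinuousLinearMap.inverse_equiv]
    exact e.apply_symm_apply _
  have hτ (y : E) (hay : ContDiffAt ℝ 1 a y) (hZy : ContDiffAt ℝ 1 Z y) : ContinuousAt τ y := by
    let tr : (E →L[ℝ] E) →ₗ[ℝ] ℝ := LinearMap.trace ℝ E ∘ₗ ContinuousLinearMap.coeLM ℝ
    have h1 : Continuous tr := tr.continuous_of_finiteDimensional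
    exact h1.continuousAt.comp
      ((hay.continuousAt_fderiv (by norm_num)).clm_comp hZy.continuousAt)
  have hτ0 : (fderiv ℝ Y x₀ - (fderiv ℝ Z x₀).flip (Y x₀)) = (fderiv ℝ a x₀).comp (Z x₀) := by
    have h1 := (hZ.differentiableAt (by norm_num)).hasFDerivAt.clm_apply
      (ha.differentiableAt (by norm_num)).hasFDerivAt
    have h2 := h1.unique
      ((hY.differentiableAt (by norm_num)).hasFDerivAt.congr_of_eventuallyEq hinv)
    have h3 : a x₀ = Y x₀ := by simpa [hZ0] using hinv.self_of_nhds
    rw [← h2, h3, hZ0]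
    ext v
    simp
  rw [hτ0]
  change τ x₀ = 0
  by_contra hc
  -- Multiplying by `τ x₀` treats both signs at once: near `x₀` the product is positive, which
  -- contradicts the vanishing of `∫ F τ` for a bump function `F`.
  have hpos : ∀ᶠ y in 𝓝 x₀, 0 < τ x₀ * τ y :=
    (continuousAt_const.mul (hτ x₀ ha hZ)).eventually (lt_mem_nhds (mul_self_pos.2 hc))
  obtain ⟨R, hR, hball⟩ := Metric.eventually_nhds_iff_ball.1
    ((ha.eventually (by simp)).and ((hZ.eventually (by simp)).and
      ((hY.eventually (by simp)).and (hinv.and (hpos.and (Metric.ball_mem_nhds x₀ hr))))))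
  let F : ContDiffBump x₀ := ⟨R / 4, R / 2, by linarith, by linarith⟩
  have hRr (y : E) (hy : y ∉ Metric.closedBall x₀ r) : y ∉ Metric.ball x₀ R := fun h =>
    hy (Metric.ball_subset_closedBall (hball y h).2.2.2.2.2)
  have hF0' (y : E) (hy : y ∉ Metric.closedBall x₀ (R / 2)) : F =ᶠ[𝓝 y] 0 := by
    filter_upwards [Metric.isClosed_closedBall.isOpen_compl.mem_nhds hy] with z hz
    refine F.zero_of_le_dist ?_
    simp only [Set.mem_compl_iff, Metric.mem_closedBall, not_le] at hz
    exact hz.le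
  have hF0 (y : E) (hy : y ∉ Metric.ball x₀ R) : F =ᶠ[𝓝 y] 0 :=
    hF0' y fun h => hy (Metric.closedBall_subset_ball (by linarith) h)
  have hintegr (H : E → ℝ) (h1 : ∀ y ∈ Metric.ball x₀ R, ContinuousAt H y)
      (h2 : ∀ y ∉ Metric.closedBall x₀ (R / 2), H y = 0) : Integrable H ν := by
    have h3 : tsupport H ⊆ Metric.closedBall x₀ (R / 2) :=
      closure_minimal (fun y hy => by_contra fun h => hy (h2 y h)) Metric.isClosed_closedBall
    exact (continuous_of_tsupport fun y hy => h1 y (Metric.closedBall_subset_ball (by linarith)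
      (h3 hy))).integrable_of_hasCompactSupport
      ((isCompact_closedBall x₀ (R / 2)).of_isClosed_subset (isClosed_tsupport H) h3)
  let b := Module.finBasis ℝ E
  let ℓ : Fin (Module.finrank ℝ E) → E →L[ℝ] ℝ := fun k =>
    LinearMap.toContinuousLinearMap (b.coord k)
  let Fa : Fin (Module.finrank ℝ E) → E → ℝ := fun k y => F y * ℓ k (a y)
  have hFaC (k) : ContDiff ℝ 1 (Fa k) := by
    rw [contDiff_iff_contDiffAt]
    intro y
    by_cases hy : y ∈ Metric.ball x₀ R
    · exact F.contDiff.contDiffAt.mul ((ℓ k).contDiff.contDiffAt.comp y (hball y hy).1)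
    · refine (contDiffAt_const (c := (0 : ℝ))).congr_of_eventuallyEq ?_
      filter_upwards [hF0 y hy] with z hz
      simp only [Fa, hz, Pi.zero_apply, zero_mul]
  have hFa0 (k) (y : E) (hy : y ∉ Metric.closedBall x₀ (R / 2)) : Fa k =ᶠ[𝓝 y] 0 := by
    filter_upwards [hF0' y hy] with z hz
    simp only [Fa, hz, Pi.zero_apply, zero_mul]
  have hZF (k) : Integrable (fun y => fderiv ℝ (Fa k) y (Z y (b k))) ν := by
    refine hintegr _ (fun y hy => ?_) fun y hy => ?_
    · exact ((hFaC k).continuous_fderiv (by norm_num)).continuousAt.clm_apply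
        ((hball y hy).2.1.continuousAt.clm_apply continuousAt_const)
    · rw [(hFa0 k y hy).fderiv_eq]
      simp
  have hYF : Integrable (fun y => fderiv ℝ F y (Y y)) ν := by
    refine hintegr _ (fun y hy => ?_) fun y hy => ?_
    · exact (F.contDiff.continuous_fderiv (n := 1) (by norm_num)).continuousAt.clm_apply
        (hball y hy).2.2.1.continuousAt
    · rw [(hF0' y hy).fderiv_eq]
      simp
  -- The product rule for `F a_k`, with `Y = ∑ a_k Z b_k`. Both terms on the right integrate to zero
  -- by hypothesis.
  have hparts (y : E) : F y * τ y = ∑ k, fderiv ℝ (Fa k) y (Z y (b k)) - fderiv ℝ F y (Y y) := by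
    by_cases hy : y ∈ Metric.ball x₀ R
    · obtain ⟨hay, -, -, hZa, -⟩ := hball y hy
      have hk (k) : fderiv ℝ (Fa k) y (Z y (b k)) =
          F y * ℓ k (fderiv ℝ a y (Z y (b k))) + ℓ k (a y) * fderiv ℝ F y (Z y (b k)) := by
        have h1 := ((F.contDiff (n := 1)).differentiable (by norm_num) y).hasFDerivAt.mul
          ((ℓ k).hasFDerivAt.comp y (hay.differentiableAt (by norm_num)).hasFDerivAt)
        have h2 : fderiv ℝ (Fa k) y = _ := h1.fderiv
        rw [h2]
        simp
      have h1 : ∑ k, ℓ k (a y) * fderiv ℝ F y (Z y (b k)) = fderiv ℝ F y (Y y) := by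
        rw [← hZa]
        have h2 : fderiv ℝ F y (Z y (∑ k, b.repr (a y) k • b k)) =
            ∑ k, ℓ k (a y) * fderiv ℝ F y (Z y (b k)) := by
          simp only [_root_.map_sum, _root_.map_smul, smul_eq_mul]
          rfl
        rw [← h2, b.sum_repr]
      have h2 : τ y = ∑ k, ℓ k (fderiv ℝ a y (Z y (b k))) := by
        simp only [τ]
        rw [LinearMap.trace_eq_matrix_trace ℝ b, Matrix.trace]
        refine Finset.sum_congr rfl fun k _ => ?_
        rw [Matrix.diag_apply, LinearMap.toMatrix_apply]
        rfl
      rw [Finset.sum_congr rfl fun k _ => hk k, Finset.sum_add_distrib, h1, h2, Finset.mul_sum]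
      ring
    · have h1 (k) : fderiv ℝ (Fa k) y = 0 := by
        rw [(hFa0 k y fun h => hy (Metric.closedBall_subset_ball (by linarith) h)).fderiv_eq]
        simp
      have h2 : fderiv ℝ F y = 0 := by
        rw [(hF0 y hy).fderiv_eq]
        simp
      simp [h1, h2, (hF0 y hy).self_of_nhds]
  have hzero : ∫ y, F y * τ y ∂ν = 0 := by
    rw [integral_congr_ae (Filter.Eventually.of_forall hparts), integral_sub
      (integrable_finsetSum _ fun k _ => hZF k) hYF, integral_finsetSum _ fun k _ => hZF k,
      hYint F F.contDiff fun y hy => (hF0 y (hRr y hy)).self_of_nhds, sub_zero]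
    refine Finset.sum_eq_zero fun k _ => hZint _ _ (hFaC k) fun y hy => ?_
    simp only [Fa, (hF0 y (hRr y hy)).self_of_nhds, Pi.zero_apply, zero_mul]
  have hFτ : Integrable (fun y => τ x₀ * (F y * τ y)) ν := by
    refine (hintegr _ (fun y hy => ?_) fun y hy => ?_).const_mul _
    · exact F.continuous.continuousAt.mul (hτ y (hball y hy).1 (hball y hy).2.1)
    · rw [(hF0' y hy).self_of_nhds, Pi.zero_apply, zero_mul]
  have hnonneg : 0 ≤ fun y => τ x₀ * (F y * τ y) := by
    intro y
    by_cases hy : y ∈ Metric.ball x₀ R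
    · have h1 := mul_nonneg (F.nonneg (x := y)) (hball y hy).2.2.2.2.1.le
      change 0 ≤ τ x₀ * (F y * τ y)
      linarith
    · simp [(hF0 y hy).self_of_nhds]
  have hae := (integral_eq_zero_iff_of_nonneg hnonneg hFτ).1
    (by rw [integral_const_mul, hzero, mul_zero])
  refine hν _ (Metric.ball_mem_nhds x₀ (show 0 < R / 4 by linarith)) (measure_mono_null ?_ hae)
  intro y hy
  have h1 : F y = 1 := F.one_of_mem_closedBall (Metric.ball_subset_closedBall hy)
  have h2 := (hball y (Metric.ball_subset_ball (by linarith) hy)).2.2.2.2.1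
  change ¬(τ x₀ * (F y * τ y) = 0)
  rw [h1, one_mul]
  exact h2.ne'

end Infinitesimal

end

/-! ### Multiplication in a chart, and the trace of the bracket at the identity. -/

noncomputable section

open MeasureTheory Measure

section GroupChart

variable {E : Type*} [NormedAddCommGroup E] [NormedSpace ℝ E]
  {G : Type*} [Group G] [TopologicalSpace G]

/-- The multiplication of a group in a chart `φ`. -/
def chartMul (φ : OpenPartialHomeomorph G E) (p : E × E) : E := φ (φ.symm p.1 * φ.symm p.2)

/-- The frame of left invariant vector fields in a chart `φ`. -/
def chartFrame (φ : OpenPartialHomeomorph G E) (y : E) : E →L[ℝ] E :=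
  (fderiv ℝ (chartMul φ) (y, φ 1)).comp (ContinuousLinearMap.inr ℝ E E)

variable {φ : OpenPartialHomeomorph G E}

omit [NormedSpace ℝ E] in
theorem chartMul_left_one (h1 : (1 : G) ∈ φ.source) {y : E} (hy : y ∈ φ.target) :
    chartMul φ (φ 1, y) = y := by
  simp [chartMul, φ.left_inv h1, φ.right_inv hy]

omit [NormedSpace ℝ E] in
theorem chartMul_right_one (h1 : (1 : G) ∈ φ.source) {y : E} (hy : y ∈ φ.target) :
    chartMul φ (y, φ 1) = y := by
  simp [chartMul, φ.left_inv h1, φ.right_inv hy]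

variable [IsTopologicalGroup G]

/-- By continuity of the group operations at the identity. The larger ball keeps products inside the
chart; the smaller one guarantees that translating a test function supported there, on either side,
keeps its support in the larger ball. -/
theorem exists_radii_chartMul (h1 : (1 : G) ∈ φ.source)
    (hm : ContDiffAt ℝ 2 (chartMul φ) (φ 1, φ 1)) :
    ∃ r ρ : ℝ, 0 < r ∧ r ≤ ρ ∧
      (∀ p ∈ Metric.closedBall (φ 1) ρ ×ˢ Metric.closedBall (φ 1) ρ, p.1 ∈ φ.target ∧
        φ.symm p.1 * φ.symm p.2 ∈ φ.source ∧ ContDiffAt ℝ 2 (chartMul φ) p) ∧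
      ∀ p ∈ Metric.closedBall (φ 1) r ×ˢ Metric.closedBall (φ 1) r,
        φ.symm p.1 * (φ.symm p.2)⁻¹ ∈ φ.source ∩ φ ⁻¹' Metric.closedBall (φ 1) ρ ∧
        (φ.symm p.2)⁻¹ * φ.symm p.1 ∈ φ.source ∩ φ ⁻¹' Metric.closedBall (φ 1) ρ := by
  have ht := φ.map_source h1
  have hs : ContinuousAt φ.symm (φ 1) := φ.continuousAt_symm ht
  have hs1 : ContinuousAt (fun p : E × E => φ.symm p.1) (φ 1, φ 1) :=
    ContinuousAt.comp (g := φ.symm) hs continuousAt_fst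
  have hs2 : ContinuousAt (fun p : E × E => φ.symm p.2) (φ 1, φ 1) :=
    ContinuousAt.comp (g := φ.symm) hs continuousAt_snd
  have hev : ∀ᶠ p : E × E in 𝓝 (φ 1, φ 1), p.1 ∈ φ.target ∧
      φ.symm p.1 * φ.symm p.2 ∈ φ.source ∧ ContDiffAt ℝ 2 (chartMul φ) p := by
    refine (continuousAt_fst.eventually_mem (φ.open_target.mem_nhds ht)).and
      (((hs1.mul hs2).eventually_mem (φ.open_source.mem_nhds ?_)).and (hm.eventually (by simp)))
    simpa [φ.left_inv h1] using h1
  obtain ⟨ρ, hρ, hρ'⟩ := Metric.nhds_basis_closedBall.eventually_iff.1 hev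
  have hnhds : φ.source ∩ φ ⁻¹' Metric.closedBall (φ 1) ρ ∈ 𝓝 (1 : G) :=
    Filter.inter_mem (φ.open_source.mem_nhds h1)
      ((φ.continuousAt h1).preimage_mem_nhds (Metric.closedBall_mem_nhds _ hρ))
  have hev2 : ∀ᶠ p : E × E in 𝓝 (φ 1, φ 1),
      φ.symm p.1 * (φ.symm p.2)⁻¹ ∈ φ.source ∩ φ ⁻¹' Metric.closedBall (φ 1) ρ ∧
      (φ.symm p.2)⁻¹ * φ.symm p.1 ∈ φ.source ∩ φ ⁻¹' Metric.closedBall (φ 1) ρ :=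
    ((hs1.mul hs2.inv).eventually_mem (by simpa [φ.left_inv h1] using hnhds)).and
      ((hs2.inv.mul hs1).eventually_mem (by simpa [φ.left_inv h1] using hnhds))
  obtain ⟨r, hr, hr'⟩ := Metric.nhds_basis_closedBall.eventually_iff.1 hev2
  refine ⟨min r ρ, ρ, lt_min hr hρ, min_le_right _ _, fun p hp => ?_, fun p hp => ?_⟩
  · rw [closedBall_prod_same] at hp
    exact hρ' hp
  · rw [closedBall_prod_same] at hp
    exact hr' (Metric.closedBall_subset_closedBall (min_le_left _ _) hp)

variable [FiniteDimensional ℝ E]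

/-- A Lie group with a cocompact discrete subgroup has a unimodular Lie algebra: the trace of the
bracket of left invariant vector fields, computed in a chart at the identity, vanishes. -/
theorem trace_fderiv_chartFrame_eq_zero [T2Space G] [LocallyCompactSpace G] (Γ : Subgroup G)
    [DiscreteTopology Γ] [CompactSpace (LeftQuotient Γ)] (h1 : (1 : G) ∈ φ.source)
    (hm : ContDiffAt ℝ 2 (chartMul φ) (φ 1, φ 1)) (w : E) :
    LinearMap.trace ℝ E (fderiv ℝ (chartFrame φ) (φ 1) w -
      (fderiv ℝ (chartFrame φ) (φ 1)).flip w).toLinearMap = 0 := by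
  borelize G
  borelize E
  set x₀ := φ 1 with hx₀
  set m := chartMul φ with hmdef
  obtain ⟨r, ρ, hr, hrρ, hρ, hr'⟩ := exists_radii_chartMul h1 hm
  rw [← hx₀] at hρ hr'
  have hρ0 : 0 < ρ := hr.trans_le hrρ
  have hx₀ρ : x₀ ∈ Metric.closedBall x₀ ρ := Metric.mem_closedBall_self hρ0.le
  have htarget : Metric.closedBall x₀ ρ ⊆ φ.target := fun y hy => (hρ (y, x₀) ⟨hy, hx₀ρ⟩).1
  let μ : Measure G := haar
  set S := φ.source ∩ φ ⁻¹' Metric.closedBall x₀ ρ with hS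
  have hSc : IsCompact S := by
    rw [hS, ← φ.symm_image_eq_source_inter_preimage htarget]
    exact (isCompact_closedBall x₀ ρ).image_of_continuousOn (φ.continuousOn_symm.mono htarget)
  have hSm : MeasurableSet S := hSc.measurableSet
  have hφS : ContinuousOn φ S := φ.continuousOn.mono Set.inter_subset_left
  have hφm : AEMeasurable φ (μ.restrict S) := hφS.aemeasurable hSm
  have : IsFiniteMeasure (μ.restrict S) := ⟨by
    rw [Measure.restrict_apply MeasurableSet.univ, Set.univ_inter]; exact hSc.measure_lt_top⟩
  let ν : Measure E := (μ.restrict S).map φ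
  have hν : ∀ U ∈ 𝓝 x₀, ν U ≠ 0 := by
    intro U hU h0
    have h2 := le_map_apply hφm U
    have h3 : φ ⁻¹' U ∩ S ∈ 𝓝 (1 : G) :=
      Filter.inter_mem ((φ.continuousAt h1).preimage_mem_nhds hU)
        (Filter.inter_mem (φ.open_source.mem_nhds h1)
          ((φ.continuousAt h1).preimage_mem_nhds (Metric.closedBall_mem_nhds _ hρ0)))
    have h4 := (measure_pos_of_mem_nhds μ h3).trans_le (le_restrict_apply S _)
    exact absurd (h2.trans_eq h0) (not_le.2 h4)
  -- For `|s| ≤ δ w` the point `x₀ + s w` stays in the smaller ball; the `+ 1` covers `w = 0`.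
  let δ (w : E) : ℝ := r / (‖w‖ + 1)
  have hδ (w : E) : 0 < δ w := div_pos hr (by positivity)
  have hsw (w : E) (s : ℝ) (hs : s ∈ Metric.closedBall (0 : ℝ) (δ w)) :
      x₀ + s • w ∈ Metric.closedBall x₀ r := by
    rw [Metric.mem_closedBall, dist_zero_right, Real.norm_eq_abs] at hs
    rw [Metric.mem_closedBall, dist_eq_norm, add_sub_cancel_left, norm_smul, Real.norm_eq_abs]
    calc |s| * ‖w‖ ≤ r / (‖w‖ + 1) * (‖w‖ + 1) := by
          gcongr
          linarith
      _ = r := div_mul_cancel₀ _ (by positivity)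
  have hsub := Metric.closedBall_subset_closedBall (x := x₀) hrρ
  have hmp (p : E × E) (hp : p ∈ Metric.closedBall x₀ ρ ×ˢ Metric.closedBall x₀ ρ) :
      ContDiffAt ℝ 1 m p := (hρ p hp).2.2.of_le (by norm_num)
  let Y : E → E := fun y => fderiv ℝ m (x₀, y) (w, 0)
  have hD : ∀ p ∈ Metric.closedBall x₀ ρ ×ˢ Metric.closedBall x₀ ρ,
      ContDiffAt ℝ 1 (fderiv ℝ m) p := fun p hp =>
    (hρ p hp).2.2.fderiv_right (m := 1) (by norm_num)
  have hZρ (y : E) (hy : y ∈ Metric.closedBall x₀ ρ) : ContDiffAt ℝ 1 (chartFrame φ) y := by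
    have h2 : ContDiffAt ℝ 1 (fun y => fderiv ℝ m (y, x₀)) y :=
      ContDiffAt.comp y (hD (y, x₀) ⟨hy, hx₀ρ⟩) (contDiffAt_id.prodMk contDiffAt_const)
    exact h2.clm_comp contDiffAt_const
  have hYρ (y : E) (hy : y ∈ Metric.closedBall x₀ ρ) : ContDiffAt ℝ 1 Y y := by
    have h2 : ContDiffAt ℝ 1 (fun y => fderiv ℝ m (x₀, y)) y :=
      ContDiffAt.comp y (hD (x₀, y) ⟨hx₀ρ, hy⟩) (contDiffAt_const.prodMk contDiffAt_id)
    exact h2.clm_apply contDiffAt_const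
  have hmap (F : E → ℝ) (hF : ContDiff ℝ 1 F) (V : E → E)
      (hV : ContinuousOn V (Metric.closedBall x₀ ρ)) :
      ∫ y, fderiv ℝ F y (V y) ∂ν = ∫ x in S, fderiv ℝ F (φ x) (V (φ x)) ∂μ := by
    have hae : ∀ᵐ y ∂ν, y ∈ Metric.closedBall x₀ ρ := by
      refine (ae_map_iff hφm (p := fun y => y ∈ Metric.closedBall x₀ ρ)
        Metric.isClosed_closedBall.measurableSet).2 ?_
      filter_upwards [ae_restrict_mem hSm] with x hx using hx.2
    have hcont : ContinuousOn (fun y => fderiv ℝ F y (V y)) (Metric.closedBall x₀ ρ) :=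
      (hF.continuous_fderiv (by norm_num)).continuousOn.clm_apply hV
    have h2 := hcont.aestronglyMeasurable (μ := ν) Metric.isClosed_closedBall.measurableSet
    rw [restrict_eq_self_of_ae_mem hae] at h2
    exact integral_map hφm h2
  have hZint (w : E) (F : E → ℝ) (hF : ContDiff ℝ 1 F)
      (hFr : ∀ y ∉ Metric.closedBall x₀ r, F y = 0) :
      ∫ y, fderiv ℝ F y (chartFrame φ y w) ∂ν = 0 := by
    have haff : ContDiff ℝ 1 (fun q : E × ℝ => (q.1, x₀ + q.2 • w)) := by fun_prop
    -- Left-invariant fields generate right translations, so this step is where the cocompact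
    -- subgroup enters.
    have h2 := integral_fderiv_eq_zero_of_integral_comp_eq μ φ
      (fun s x => x * φ.symm (x₀ + s • w)) (fun q => m (q.1, x₀ + q.2 • w)) (hδ w) hrρ htarget
      (fun q hq => ContDiffAt.comp q (g := m) (hmp (q.1, x₀ + q.2 • w) ⟨hq.1, hsub (hsw w _ hq.2)⟩)
        haff.contDiffAt)
      (fun s hs x hx hxρ => by
        have h3 := (hρ (φ x, x₀ + s • w) ⟨hxρ, hsub (hsw w s hs)⟩).2.1
        simp only [φ.left_inv hx] at h3
        exact ⟨h3, by simp [hmdef, chartMul, φ.left_inv hx]⟩)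
      (fun s hs x hx hxr => by
        have h3 := (hr' (φ (x * φ.symm (x₀ + s • w)), x₀ + s • w) ⟨hxr, hsw w s hs⟩).1
        simp only [φ.left_inv hx, mul_inv_cancel_right] at h3
        exact h3)
      (fun y hy => by simpa using chartMul_right_one h1 (htarget hy))
      (fun f hf hfc s => LeftQuotient.integral_mul_right_eq_self μ Γ hf hfc _) F hF hFr
    rw [hmap F hF (fun y => chartFrame φ y w) fun y hy =>
      ((hZρ y hy).continuousAt.clm_apply continuousAt_const).continuousWithinAt]
    refine (setIntegral_congr_fun hSm fun x hx => ?_).trans h2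
    have h3 : HasFDerivAt (fun q : E × ℝ => (q.1, x₀ + q.2 • w))
        ((ContinuousLinearMap.fst ℝ E ℝ).prod
          ((ContinuousLinearMap.snd ℝ E ℝ).smulRight w)) (φ x, 0) :=
      hasFDerivAt_fst.prodMk ((hasFDerivAt_snd.smul_const w).const_add x₀)
    have h4 : HasFDerivAt m (fderiv ℝ m (φ x, x₀)) (φ x, x₀ + (0 : ℝ) • w) := by
      simpa using ((hmp (φ x, x₀) ⟨hx.2, hx₀ρ⟩).differentiableAt (by norm_num)).hasFDerivAt
    have h5 := (h4.comp (φ x, (0 : ℝ)) h3).fderiv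
    simp only [Function.comp_def] at h5
    simp only [h5]
    simp [chartFrame, hmdef, hx₀]
  have hYint (F : E → ℝ) (hF : ContDiff ℝ 1 F)
      (hFr : ∀ y ∉ Metric.closedBall x₀ r, F y = 0) :
      ∫ y, fderiv ℝ F y (Y y) ∂ν = 0 := by
    have haff : ContDiff ℝ 1 (fun q : E × ℝ => (x₀ + q.2 • w, q.1)) := by fun_prop
    -- Right-invariant fields such as `Y` generate left translations, which preserve Haar measure on
    -- any group.
    have h2 := integral_fderiv_eq_zero_of_integral_comp_eq μ φ
      (fun s x => φ.symm (x₀ + s • w) * x) (fun q => m (x₀ + q.2 • w, q.1)) (hδ w) hrρ htarget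
      (fun q hq => ContDiffAt.comp q (g := m) (hmp (x₀ + q.2 • w, q.1) ⟨hsub (hsw w _ hq.2), hq.1⟩)
        haff.contDiffAt)
      (fun s hs x hx hxρ => by
        have h3 := (hρ (x₀ + s • w, φ x) ⟨hsub (hsw w s hs), hxρ⟩).2.1
        simp only [φ.left_inv hx] at h3
        exact ⟨h3, by simp [hmdef, chartMul, φ.left_inv hx]⟩)
      (fun s hs x hx hxr => by
        have h3 := (hr' (φ (φ.symm (x₀ + s • w) * x), x₀ + s • w) ⟨hxr, hsw w s hs⟩).2
        simp only [φ.left_inv hx, inv_mul_cancel_left] at h3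
        exact h3)
      (fun y hy => by simpa using chartMul_left_one h1 (htarget hy))
      (fun f hf hfc s => integral_mul_left_eq_self f _) F hF hFr
    rw [hmap F hF Y fun y hy => (hYρ y hy).continuousAt.continuousWithinAt]
    refine (setIntegral_congr_fun hSm fun x hx => ?_).trans h2
    have h3 : HasFDerivAt (fun q : E × ℝ => (x₀ + q.2 • w, q.1))
        (((ContinuousLinearMap.snd ℝ E ℝ).smulRight w).prod
          (ContinuousLinearMap.fst ℝ E ℝ)) (φ x, 0) :=
      ((hasFDerivAt_snd.smul_const w).const_add x₀).prodMk hasFDerivAt_fst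
    have h4 : HasFDerivAt m (fderiv ℝ m (x₀, φ x)) (x₀ + (0 : ℝ) • w, φ x) := by
      simpa using ((hmp (x₀, φ x) ⟨hx₀ρ, hx.2⟩).differentiableAt (by norm_num)).hasFDerivAt
    have h5 := (h4.comp (φ x, (0 : ℝ)) h3).fderiv
    simp only [Function.comp_def] at h5
    simp [h5, Y]
  have hmd := (hmp (x₀, x₀) ⟨hx₀ρ, hx₀ρ⟩).differentiableAt (by norm_num)
  have htn : φ.target ∈ 𝓝 x₀ := φ.open_target.mem_nhds (htarget hx₀ρ)
  have hZ0 : chartFrame φ x₀ = ContinuousLinearMap.id ℝ E := by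
    have h2 : HasFDerivAt (fun z => m (x₀, z)) (chartFrame φ x₀) x₀ :=
      hmd.hasFDerivAt.comp x₀ (hasFDerivAt_prodMk_right x₀ x₀)
    refine h2.unique ((hasFDerivAt_id x₀).congr_of_eventuallyEq ?_)
    filter_upwards [htn] with z hz using chartMul_left_one h1 hz
  have hY0 : Y x₀ = w := by
    have h2 : HasFDerivAt (fun z => m (z, x₀)) _ x₀ :=
      HasFDerivAt.comp (f := fun z => (z, x₀)) x₀ hmd.hasFDerivAt (hasFDerivAt_prodMk_left x₀ x₀)
    have h3 := h2.unique ((hasFDerivAt_id x₀).congr_of_eventuallyEq (by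
      filter_upwards [htn] with z hz using chartMul_right_one h1 hz))
    simpa using DFunLike.congr_fun h3 w
  have key := trace_eq_zero_of_integral_fderiv_eq_zero ν hν (hZρ x₀ hx₀ρ) (hYρ x₀ hx₀ρ) hZ0 hr
    hZint hYint
  rw [hY0] at key
  -- Both sides are the mixed second derivative of the multiplication at the identity, taken in the
  -- two possible orders.
  have hsymm : fderiv ℝ Y x₀ = fderiv ℝ (chartFrame φ) x₀ w := by
    have hDd := ((hD (x₀, x₀) ⟨hx₀ρ, hx₀ρ⟩).differentiableAt (by norm_num)).hasFDerivAt
    have h2 : HasFDerivAt (fun y => fderiv ℝ m (x₀, y)) _ x₀ :=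
      hDd.comp x₀ (hasFDerivAt_prodMk_right x₀ x₀)
    have h3 : HasFDerivAt (fun y => fderiv ℝ m (y, x₀)) _ x₀ :=
      HasFDerivAt.comp (f := fun z => (z, x₀)) x₀ hDd (hasFDerivAt_prodMk_left x₀ x₀)
    have h4 : HasFDerivAt Y _ x₀ := h2.clm_apply (hasFDerivAt_const (w, (0 : E)) x₀)
    have h5 : HasFDerivAt (chartFrame φ) _ x₀ :=
      h3.clm_comp (hasFDerivAt_const (ContinuousLinearMap.inr ℝ E E) x₀)
    rw [h4.fderiv, h5.fderiv]
    ext v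
    simpa using ((hρ (x₀, x₀) ⟨hx₀ρ, hx₀ρ⟩).2.2.isSymmSndFDerivAt (by simp)).eq ((0 : E), v)
      (w, (0 : E))
  rwa [hsymm] at key

end GroupChart

end

/-! ### Left-invariant frame, Lie bracket and Maurer-Cartan form in holomorphic charts. -/

noncomputable section

section LeftFrame

open VectorField

variable {E : Type*} [NormedAddCommGroup E] [NormedSpace ℂ E]
  {G : Type*} [Group G] [TopologicalSpace G] [ChartedSpace E G]

/-- The frame of left invariant vector fields on the complex Lie group `G`, in the chart `ε`. -/
def leftFrame (ε : OpenPartialHomeomorph G E) (y : E) : E →L[ℂ] E :=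
  (ContinuousLinearMap.inverse (mfderiv 𝓘(ℂ, E) 𝓘(ℂ, E) ε.symm y : E →L[ℂ] E)).comp
    (mfderiv 𝓘(ℂ, E) 𝓘(ℂ, E) (fun c : G => ε.symm y * c) 1 : E →L[ℂ] E)

variable [LieGroup 𝓘(ℂ, E) ω G] {ε : OpenPartialHomeomorph G E}

omit [Group G] [LieGroup 𝓘(ℂ, E) ω G] in
theorem isInvertible_mfderiv_chart_symm (hε : ε ∈ IsManifold.maximalAtlas 𝓘(ℂ, E) ω G) {y : E}
    (hy : y ∈ ε.target) :
    (mfderiv 𝓘(ℂ, E) 𝓘(ℂ, E) ε.symm y : E →L[ℂ] E).IsInvertible := by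
  have hd : ε.MDifferentiable 𝓘(ℂ, E) 𝓘(ℂ, E) :=
    ⟨(contMDiffOn_of_mem_maximalAtlas hε).mdifferentiableOn (by simp),
      (contMDiffOn_symm_of_mem_maximalAtlas hε).mdifferentiableOn (by simp)⟩
  exact ⟨hd.symm.mfderiv hy, rfl⟩

theorem isInvertible_mfderiv_mul_left (a b : G) :
    (mfderiv 𝓘(ℂ, E) 𝓘(ℂ, E) (fun c : G => a * c) b : E →L[ℂ] E).IsInvertible := by
  have h1 (a b : G) : MDifferentiableAt 𝓘(ℂ, E) 𝓘(ℂ, E) (fun c : G => a * c) b :=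
    (contMDiff_mul_left (I := 𝓘(ℂ, E)) (n := ω)).contMDiffAt.mdifferentiableAt (by simp)
  have h2 (a b : G) : ContinuousLinearMap.comp
      (mfderiv 𝓘(ℂ, E) 𝓘(ℂ, E) (fun c : G => a⁻¹ * c) (a * b) : E →L[ℂ] E)
      (mfderiv 𝓘(ℂ, E) 𝓘(ℂ, E) (fun c : G => a * c) b : E →L[ℂ] E) =
      ContinuousLinearMap.id ℂ E := by
    have h3 := mfderiv_comp b (h1 a⁻¹ (a * b)) (h1 a b)
    have h4 : ((fun c : G => a⁻¹ * c) ∘ fun c : G => a * c) = id := by ext; simp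
    rw [h4, mfderiv_id] at h3
    exact h3.symm
  refine ⟨ContinuousLinearEquiv.equivOfInverse
    (mfderiv 𝓘(ℂ, E) 𝓘(ℂ, E) (fun c : G => a * c) b : E →L[ℂ] E)
    (mfderiv 𝓘(ℂ, E) 𝓘(ℂ, E) (fun c : G => a⁻¹ * c) (a * b) : E →L[ℂ] E)
    (fun v => DFunLike.congr_fun (h2 a b) v) (fun v => ?_), rfl⟩
  have h5 := h2 a⁻¹ (a * b)
  rw [inv_inv, inv_mul_cancel_left] at h5
  exact DFunLike.congr_fun h5 v

theorem isInvertible_leftFrame (hε : ε ∈ IsManifold.maximalAtlas 𝓘(ℂ, E) ω G) {y : E}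
    (hy : y ∈ ε.target) : (leftFrame ε y).IsInvertible :=
  (isInvertible_mfderiv_chart_symm hε hy).inverse.comp (isInvertible_mfderiv_mul_left _ _)

variable [FiniteDimensional ℂ E]

theorem contDiffAt_leftFrame (hε : ε ∈ IsManifold.maximalAtlas 𝓘(ℂ, E) ω G) {y : E}
    (hy : y ∈ ε.target) : ContDiffAt ℂ 2 (leftFrame ε) y := by
  have : CompleteSpace E := FiniteDimensional.complete ℂ E
  have : LieGroup 𝓘(ℂ, E) (minSmoothness ℂ 3) G := LieGroup.of_le (n := ω) le_top
  rw [contDiffAt_clm_apply_iff]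
  intro v
  have h1 := contMDiffAt_mulInvariantVectorField (I := 𝓘(ℂ, E)) (G := G) v (g := ε.symm y)
  have h2 := ContMDiffAt.mpullback_vectorField_preimage (n := ω) (h1.of_le le_minSmoothness)
    (contMDiffAt_symm_of_mem_maximalAtlas hε hy) (isInvertible_mfderiv_chart_symm hε hy) le_top
  exact contMDiffAt_vectorSpace_iff_contDiffAt.1 h2

variable (E G) in
/-- The bracket of the Lie algebra of `G`, as a bilinear map on the model space. -/
def lieBracketBilin : E →ₗ[ℂ] E →ₗ[ℂ] E :=
  haveI : CompleteSpace E := FiniteDimensional.complete ℂ E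
  haveI : LieGroup 𝓘(ℂ, E) (minSmoothness ℂ 3) G := LieGroup.of_le (n := ω) le_top
  -- Bilinearity holds over `ℂ` because `G` is a complex Lie group; this is the source of `β(J u, v)
  -- = J β(u, v) = β(u, J v)`.
  LinearMap.mk₂ ℂ
    (fun u v => mlieBracket 𝓘(ℂ, E) (mulInvariantVectorField (I := 𝓘(ℂ, E)) (G := G) u)
      (mulInvariantVectorField (I := 𝓘(ℂ, E)) (G := G) v) 1)
    (fun u u' v => add_lie (L := GroupLieAlgebra 𝓘(ℂ, E) G) (M := GroupLieAlgebra 𝓘(ℂ, E) G) u u' v)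
    (fun c u v => smul_lie (L := GroupLieAlgebra 𝓘(ℂ, E) G) (M := GroupLieAlgebra 𝓘(ℂ, E) G) c u v)
    (fun u v v' => lie_add (L := GroupLieAlgebra 𝓘(ℂ, E) G) (M := GroupLieAlgebra 𝓘(ℂ, E) G) u v v')
    (fun c u v => lie_smul (L := GroupLieAlgebra 𝓘(ℂ, E) G) (M := GroupLieAlgebra 𝓘(ℂ, E) G) c u v)

theorem lieBracketBilin_swap (u v : E) : lieBracketBilin E G u v = -lieBracketBilin E G v u :=
  mlieBracket_swap_apply

omit [FiniteDimensional ℂ E] in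
theorem mlieBracket_eq_lieBracket_model {V W : Π x : E, TangentSpace 𝓘(ℂ, E) x} :
    mlieBracket 𝓘(ℂ, E) V W = lieBracket ℂ V W := by
  rw [← mlieBracketWithin_univ, mlieBracketWithin_eq_lieBracketWithin]
  exact lieBracketWithin_univ

/-- The frame is the pullback by the chart inverse of the left-invariant fields. Pullback commutes
with brackets, and the bracket of left-invariant fields is again left-invariant. -/
theorem lieBracket_leftFrame (hε : ε ∈ IsManifold.maximalAtlas 𝓘(ℂ, E) ω G) {y : E}
    (hy : y ∈ ε.target) (u v : E) :
    lieBracket ℂ (fun z => leftFrame ε z u) (fun z => leftFrame ε z v) y =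
      leftFrame ε y (lieBracketBilin E G u v) := by
  have : CompleteSpace E := FiniteDimensional.complete ℂ E
  have : LieGroup 𝓘(ℂ, E) (minSmoothness ℂ 3) G := LieGroup.of_le (n := ω) le_top
  let V (w : E) := mulInvariantVectorField (I := 𝓘(ℂ, E)) (G := G) w
  have h1 : mpullback 𝓘(ℂ, E) 𝓘(ℂ, E) ε.symm (mlieBracket 𝓘(ℂ, E) (V u) (V v)) y =
      mlieBracket 𝓘(ℂ, E) (mpullback 𝓘(ℂ, E) 𝓘(ℂ, E) ε.symm (V u))
        (mpullback 𝓘(ℂ, E) 𝓘(ℂ, E) ε.symm (V v)) y :=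
    mpullback_mlieBracket (n := ω) (mdifferentiableAt_mulInvariantVectorField _)
      (mdifferentiableAt_mulInvariantVectorField _)
      (contMDiffAt_symm_of_mem_maximalAtlas hε hy) le_top
  have h2 : V (lieBracketBilin E G u v) = mlieBracket 𝓘(ℂ, E) (V u) (V v) :=
    mulInvariantVector_mlieBracket (I := 𝓘(ℂ, E)) (G := G) u v
  rw [← h2] at h1
  exact ((congrFun mlieBracket_eq_lieBracket_model y).symm.trans h1.symm)

variable (E G) in
/-- The bracket of the Lie algebra of `G`, as a real bilinear map on the model space. -/
def lieBracketCLM : E →L[ℝ] E →L[ℝ] E :=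
  haveI : FiniteDimensional ℝ E := FiniteDimensional.complexToReal E
  LinearMap.toContinuousLinearMap
    { toFun := fun u =>
        (LinearMap.toContinuousLinearMap (lieBracketBilin E G u)).restrictScalars ℝ
      map_add' := fun u u' => by ext v; simp
      map_smul' := fun c u => by
        ext v
        change lieBracketBilin E G ((c : ℂ) • u) v = (c : ℂ) • lieBracketBilin E G u v
        rw [map_smul, LinearMap.smul_apply] }

@[simp]
theorem lieBracketCLM_apply (u v : E) : lieBracketCLM E G u v = lieBracketBilin E G u v := rfl

/-- The Maurer-Cartan form of `G` in the chart `ε`. -/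
def maurerCartanForm (ε : OpenPartialHomeomorph G E) (y : E) : E →L[ℝ] E :=
  (ContinuousLinearMap.inverse (leftFrame ε y)).restrictScalars ℝ

theorem contDiffAt_inverse_leftFrame (hε : ε ∈ IsManifold.maximalAtlas 𝓘(ℂ, E) ω G) {y : E}
    (hy : y ∈ ε.target) :
    ContDiffAt ℂ 2 (fun z => ContinuousLinearMap.inverse (leftFrame ε z)) y := by
  have : CompleteSpace E := FiniteDimensional.complete ℂ E
  obtain ⟨e, he⟩ := isInvertible_leftFrame hε hy
  have h1 : ContDiffAt ℂ 2 (ContinuousLinearMap.inverse : (E →L[ℂ] E) → E →L[ℂ] E)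
      (leftFrame ε y) := by
    rw [← he]; exact contDiffAt_map_inverse e
  exact h1.comp y (contDiffAt_leftFrame hε hy)

theorem contDiffAt_maurerCartanForm (hε : ε ∈ IsManifold.maximalAtlas 𝓘(ℂ, E) ω G) {y : E}
    (hy : y ∈ ε.target) : ContDiffAt ℝ 2 (maurerCartanForm ε) y :=
  (ContinuousLinearMap.restrictScalarsL ℂ E E ℝ ℝ).contDiff.contDiffAt.comp y
    ((contDiffAt_inverse_leftFrame hε hy).restrict_scalars ℝ)

omit [FiniteDimensional ℂ E] in
theorem maurerCartanForm_leftFrame (hε : ε ∈ IsManifold.maximalAtlas 𝓘(ℂ, E) ω G) {y : E}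
    (hy : y ∈ ε.target) (u : E) : maurerCartanForm ε y (leftFrame ε y u) = u := by
  obtain ⟨e, he⟩ := isInvertible_leftFrame hε hy
  change ContinuousLinearMap.inverse (leftFrame ε y) (leftFrame ε y u) = u
  rw [← he, ContinuousLinearMap.inverse_equiv]
  exact e.symm_apply_apply u

omit [FiniteDimensional ℂ E] in
theorem leftFrame_maurerCartanForm (hε : ε ∈ IsManifold.maximalAtlas 𝓘(ℂ, E) ω G) {y : E}
    (hy : y ∈ ε.target) (u : E) : leftFrame ε y (maurerCartanForm ε y u) = u := by
  obtain ⟨e, he⟩ := isInvertible_leftFrame hε hy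
  change leftFrame ε y (ContinuousLinearMap.inverse (leftFrame ε y) u) = u
  rw [← he, ContinuousLinearMap.inverse_equiv]
  exact e.apply_symm_apply u

omit [FiniteDimensional ℂ E] in
theorem isInvertible_maurerCartanForm (hε : ε ∈ IsManifold.maximalAtlas 𝓘(ℂ, E) ω G) {y : E}
    (hy : y ∈ ε.target) : (maurerCartanForm ε y).IsInvertible :=
  ⟨ContinuousLinearEquiv.equivOfInverse (maurerCartanForm ε y)
    ((leftFrame ε y).restrictScalars ℝ) (leftFrame_maurerCartanForm hε hy)
    (maurerCartanForm_leftFrame hε hy), rfl⟩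

theorem hasFDerivAt_leftFrame_apply (hε : ε ∈ IsManifold.maximalAtlas 𝓘(ℂ, E) ω G) {y : E}
    (hy : y ∈ ε.target) (u : E) : HasFDerivAt (fun z => leftFrame ε z u)
      (((fderiv ℂ (leftFrame ε) y).flip u).restrictScalars ℝ) y := by
  have h1 := ((contDiffAt_leftFrame hε hy).differentiableAt (by norm_num)).hasFDerivAt.clm_apply
    (hasFDerivAt_const u y)
  simpa using h1.restrictScalars ℝ

/-- The Maurer-Cartan equation. -/
theorem fderiv_maurerCartanForm (hε : ε ∈ IsManifold.maximalAtlas 𝓘(ℂ, E) ω G) {y : E}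
    (hy : y ∈ ε.target) (A B : E) :
    fderiv ℝ (maurerCartanForm ε) y A B - fderiv ℝ (maurerCartanForm ε) y B A =
      -lieBracketCLM E G (maurerCartanForm ε y A) (maurerCartanForm ε y B) := by
  -- Differentiating the constant `P(Z u) = u` transfers derivatives of the coframe to the frame,
  -- whose bracket is known.
  have key (A u : E) : fderiv ℝ (maurerCartanForm ε) y A (leftFrame ε y u) =
      -maurerCartanForm ε y (fderiv ℂ (leftFrame ε) y A u) := by
    have h1 := ((contDiffAt_maurerCartanForm hε hy).differentiableAt
      (by norm_num)).hasFDerivAt.clm_apply (hasFDerivAt_leftFrame_apply hε hy u)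
    have h2 : (fun z => maurerCartanForm ε z (leftFrame ε z u)) =ᶠ[𝓝 y] fun _ => u := by
      filter_upwards [ε.open_target.mem_nhds hy] with z hz
      exact maurerCartanForm_leftFrame hε hz u
    have h3 := DFunLike.congr_fun (h1.unique ((hasFDerivAt_const u y).congr_of_eventuallyEq h2)) A
    have h4 : maurerCartanForm ε y (fderiv ℂ (leftFrame ε) y A u) +
        fderiv ℝ (maurerCartanForm ε) y A (leftFrame ε y u) = 0 := h3
    exact eq_neg_of_add_eq_zero_right h4
  set u := maurerCartanForm ε y A with hu
  set v := maurerCartanForm ε y B with hv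
  have hA : A = leftFrame ε y u := (leftFrame_maurerCartanForm hε hy A).symm
  have hB : B = leftFrame ε y v := (leftFrame_maurerCartanForm hε hy B).symm
  have hfd (u : E) : fderiv ℂ (fun z => leftFrame ε z u) y = (fderiv ℂ (leftFrame ε) y).flip u := by
    have h1 := ((contDiffAt_leftFrame hε hy).differentiableAt (by norm_num)).hasFDerivAt.clm_apply
      (hasFDerivAt_const u y)
    rw [h1.fderiv]
    simp
  have hb := congrArg (maurerCartanForm ε y) (lieBracket_leftFrame hε hy u v)
  rw [maurerCartanForm_leftFrame hε hy, lieBracket, hfd, hfd, map_sub,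
    ContinuousLinearMap.flip_apply, ContinuousLinearMap.flip_apply, ← hA, ← hB] at hb
  rw [lieBracketCLM_apply, ← hb]
  have hAv := key A v
  have hBu := key B u
  rw [← hB] at hAv
  rw [← hA] at hBu
  rw [hAv, hBu]
  abel

end LeftFrame

end

/-! ### Unimodularity of the Lie algebra. -/

noncomputable section

section Unimodular

variable {E : Type*} [NormedAddCommGroup E] [NormedSpace ℂ E]
  {G : Type*} [Group G] [TopologicalSpace G] [ChartedSpace E G]
  [LieGroup 𝓘(ℂ, E) ω G] {φ : OpenPartialHomeomorph G E}

theorem contDiffAt_chartMul (hφ : φ ∈ IsManifold.maximalAtlas 𝓘(ℂ, E) ω G)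
    (h1 : (1 : G) ∈ φ.source) {y : E} (hy : y ∈ φ.target) :
    ContDiffAt ℂ ω (chartMul φ) (y, φ 1) := by
  have h2 : ContMDiffAt 𝓘(ℂ, E × E) 𝓘(ℂ, E) ω (fun p : E × E => φ.symm p.1) (y, φ 1) :=
    ContMDiffAt.comp (y, φ 1) (g := φ.symm) (f := Prod.fst)
      (contMDiffAt_symm_of_mem_maximalAtlas hφ hy) contDiff_fst.contMDiff.contMDiffAt
  have h3 : ContMDiffAt 𝓘(ℂ, E × E) 𝓘(ℂ, E) ω (fun p : E × E => φ.symm p.2) (y, φ 1) :=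
    ContMDiffAt.comp (y, φ 1) (g := φ.symm) (f := Prod.snd)
      (contMDiffAt_symm_of_mem_maximalAtlas hφ (φ.map_source h1))
      contDiff_snd.contMDiff.contMDiffAt
  refine (ContMDiffAt.comp (y, φ 1) (g := φ) (contMDiffAt_of_mem_maximalAtlas hφ ?_)
    (h2.mul h3)).contDiffAt
  simpa [φ.left_inv h1] using φ.map_target hy

/-- Chain rule for `φ(φ⁻¹(y) · φ⁻¹(z))` in `z`. The two frames differ by the differential of the
chart inverse at the identity. -/
theorem chartFrame_apply (hφ : φ ∈ IsManifold.maximalAtlas 𝓘(ℂ, E) ω G)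
    (h1 : (1 : G) ∈ φ.source) {y : E} (hy : y ∈ φ.target) (w : E) :
    chartFrame φ y w =
      leftFrame φ y ((mfderiv 𝓘(ℂ, E) 𝓘(ℂ, E) φ.symm (φ 1) : E →L[ℂ] E) w) := by
  have hd : φ.MDifferentiable 𝓘(ℂ, E) 𝓘(ℂ, E) :=
    ⟨(contMDiffOn_of_mem_maximalAtlas hφ).mdifferentiableOn (by simp),
      (contMDiffOn_symm_of_mem_maximalAtlas hφ).mdifferentiableOn (by simp)⟩
  have hx := φ.map_source h1
  have hinv : ContinuousLinearMap.inverse (mfderiv 𝓘(ℂ, E) 𝓘(ℂ, E) φ.symm y : E →L[ℂ] E) =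
      (mfderiv 𝓘(ℂ, E) 𝓘(ℂ, E) φ (φ.symm y) : E →L[ℂ] E) :=
    ContinuousLinearMap.inverse_equiv (hd.symm.mfderiv hy)
  have e1 : HasMFDerivAt 𝓘(ℂ, E) 𝓘(ℂ, E) φ.symm (φ 1) (mfderiv 𝓘(ℂ, E) 𝓘(ℂ, E) φ.symm (φ 1)) :=
    (hd.mdifferentiableAt_symm hx).hasMFDerivAt
  have e2 : HasMFDerivAt 𝓘(ℂ, E) 𝓘(ℂ, E) (fun c : G => φ.symm y * c) (φ.symm (φ 1))
      (mfderiv 𝓘(ℂ, E) 𝓘(ℂ, E) (fun c : G => φ.symm y * c) 1) := by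
    rw [φ.left_inv h1]
    exact ((contMDiff_mul_left (I := 𝓘(ℂ, E)) (n := ω)).contMDiffAt.mdifferentiableAt
      (by simp)).hasMFDerivAt
  have e3 : HasMFDerivAt 𝓘(ℂ, E) 𝓘(ℂ, E) φ (φ.symm y * φ.symm (φ 1))
      (mfderiv 𝓘(ℂ, E) 𝓘(ℂ, E) φ (φ.symm y)) := by
    rw [φ.left_inv h1, mul_one]
    exact (hd.mdifferentiableAt (φ.map_target hy)).hasMFDerivAt
  have e4 := (e3.comp (φ 1) (e2.comp (φ 1) e1)).hasFDerivAt
  have e5 : HasFDerivAt (fun z : E => chartMul φ (y, z))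
      ((fderiv ℝ (chartMul φ) (y, φ 1)).comp (ContinuousLinearMap.inr ℝ E E)) (φ 1) :=
    HasFDerivAt.comp (φ 1) (((contDiffAt_chartMul hφ h1 hy).restrict_scalars ℝ).differentiableAt
      (by simp)).hasFDerivAt (hasFDerivAt_prodMk_right y (φ 1))
  have e6 := DFunLike.congr_fun (e5.unique (e4.restrictScalars ℝ)) w
  rw [leftFrame, hinv]
  exact e6

omit [LieGroup 𝓘(ℂ, E) ω G] in
theorem leftFrame_chart_one (h1 : (1 : G) ∈ φ.source) :
    leftFrame φ (φ 1) =
      ContinuousLinearMap.inverse (mfderiv 𝓘(ℂ, E) 𝓘(ℂ, E) φ.symm (φ 1) : E →L[ℂ] E) := by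
  have h : mfderiv 𝓘(ℂ, E) 𝓘(ℂ, E) (fun c : G => φ.symm (φ 1) * c) 1 =
      ContinuousLinearMap.id ℂ E := by
    have : (fun c : G => φ.symm (φ 1) * c) = id := by ext c; simp [φ.left_inv h1]
    rw [this]
    exact mfderiv_id
  rw [leftFrame]
  exact (congrArg _ h).trans (ContinuousLinearMap.comp_id _)

variable [FiniteDimensional ℂ E]

/-- The Lie algebra of a complex Lie group with a cocompact discrete subgroup is unimodular. -/
theorem trace_lieBracketCLM_eq_zero (Γ : Subgroup G) [DiscreteTopology Γ]
    [CompactSpace (LeftQuotient Γ)] (u : E) :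
    LinearMap.trace ℝ E (lieBracketCLM E G u).toLinearMap = 0 := by
  have : FiniteDimensional ℝ E := FiniteDimensional.complexToReal E
  have : IsTopologicalGroup G := topologicalGroup_of_lieGroup 𝓘(ℂ, E) ω
  have : T1Space G := 𝓘(ℂ, E).t1Space G
  have : ProperSpace E := FiniteDimensional.proper ℂ E
  have : LocallyCompactSpace G := ChartedSpace.locallyCompactSpace E G
  let φ := chartAt E (1 : G)
  have hφ : φ ∈ IsManifold.maximalAtlas 𝓘(ℂ, E) ω G := IsManifold.chart_mem_maximalAtlas _
  have h1 : (1 : G) ∈ φ.source := mem_chart_source E 1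
  have hx : φ 1 ∈ φ.target := φ.map_source h1
  obtain ⟨j, hj⟩ : ∃ j : E ≃L[ℂ] E,
      (j : E →L[ℂ] E) = mfderiv 𝓘(ℂ, E) 𝓘(ℂ, E) φ.symm (φ 1) :=
    isInvertible_mfderiv_chart_symm hφ hx
  have hframe : leftFrame φ (φ 1) = j.symm := by
    rw [leftFrame_chart_one h1, ← hj]
    exact ContinuousLinearMap.inverse_equiv j
  have hcf (w : E) : (fun y => chartFrame φ y w) =ᶠ[𝓝 (φ 1)] fun y => leftFrame φ y (j w) := by
    filter_upwards [φ.open_target.mem_nhds hx] with y hy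
    rw [chartFrame_apply hφ h1 hy, ← hj]
    rfl
  have hsm : ContDiffAt ℝ 2 (chartMul φ) (φ 1, φ 1) :=
    ((contDiffAt_chartMul hφ h1 hx).restrict_scalars ℝ).of_le le_top
  have hdiff : DifferentiableAt ℝ (chartFrame φ) (φ 1) := by
    have h2 : ContDiffAt ℝ 1 (fderiv ℝ (chartMul φ)) (φ 1, φ 1) :=
      hsm.fderiv_right (by norm_num)
    have h3 : DifferentiableAt ℝ (fun y => fderiv ℝ (chartMul φ) (y, φ 1)) (φ 1) :=
      DifferentiableAt.comp (φ 1) (f := fun y : E => (y, φ 1)) (h2.differentiableAt (by simp))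
        (by fun_prop)
    exact h3.clm_comp (differentiableAt_const _)
  have hfd (w v : E) : fderiv ℝ (chartFrame φ) (φ 1) v w =
      fderiv ℂ (leftFrame φ) (φ 1) v (j w) := by
    have h2 := (hdiff.hasFDerivAt.clm_apply (hasFDerivAt_const w (φ 1))).unique
      ((hasFDerivAt_leftFrame_apply hφ hx (j w)).congr_of_eventuallyEq (hcf w))
    simpa using DFunLike.congr_fun h2 v
  have hfc (u : E) : fderiv ℂ (fun z => leftFrame φ z u) (φ 1) =
      (fderiv ℂ (leftFrame φ) (φ 1)).flip u := by
    rw [(((contDiffAt_leftFrame hφ hx).differentiableAt (by norm_num)).hasFDerivAt.clm_apply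
      (hasFDerivAt_const u (φ 1))).fderiv]
    simp
  -- The chart computation gives `ad` conjugated by `j`; the trace does not see the conjugation.
  have hconj : (fderiv ℝ (chartFrame φ) (φ 1) (j.symm u) -
      (fderiv ℝ (chartFrame φ) (φ 1)).flip (j.symm u)).toLinearMap =
      ((j.symm.toLinearEquiv.restrictScalars ℝ).conj (lieBracketCLM E G u).toLinearMap) := by
    ext v
    have hb := lieBracket_leftFrame hφ hx u (j v)
    rw [VectorField.lieBracket, hfc, hfc, hframe] at hb
    change fderiv ℝ (chartFrame φ) (φ 1) (j.symm u) v -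
      fderiv ℝ (chartFrame φ) (φ 1) v (j.symm u) = j.symm (lieBracketBilin E G u (j v))
    rw [hfd, hfd, j.apply_symm_apply]
    simpa using hb
  have htr := trace_fderiv_chartFrame_eq_zero Γ h1 hsm (j.symm u)
  rwa [hconj, LinearMap.trace_conj'] at htr

end Unimodular

end

/-! ### Left-invariant metrics, their descent to the quotient, and the conclusion. -/

noncomputable section

section Pullback

variable {E : Type*} [NormedAddCommGroup E] [NormedSpace ℂ E]
  {M : Type*} [TopologicalSpace M] [ChartedSpace E M]
  {N : Type*} [TopologicalSpace N] [ChartedSpace E N]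
  {K : Type*} [TopologicalSpace K] [ChartedSpace E K]

theorem pullbackForm_apply (f : N → M) (x : N) (h : E →L[ℝ] E →L[ℝ] ℝ) (u v : E) :
    pullbackForm E f x h u v = h ((mfderiv 𝓘(ℂ, E) 𝓘(ℂ, E) f x : E →L[ℂ] E) u)
      ((mfderiv 𝓘(ℂ, E) 𝓘(ℂ, E) f x : E →L[ℂ] E) v) := rfl

theorem pullbackForm_congr {f f' : N → M} {x : N} (hf : f =ᶠ[𝓝 x] f')
    (h : E →L[ℝ] E →L[ℝ] ℝ) : pullbackForm E f x h = pullbackForm E f' x h :=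
  congrArg (fun L : E →L[ℂ] E => h.bilinearComp (L.restrictScalars ℝ) (L.restrictScalars ℝ))
    hf.mfderiv_eq

theorem pullbackForm_comp {f : N → M} {k : K → N} {x : K}
    (hf : MDifferentiableAt 𝓘(ℂ, E) 𝓘(ℂ, E) f (k x))
    (hk : MDifferentiableAt 𝓘(ℂ, E) 𝓘(ℂ, E) k x) (h : E →L[ℝ] E →L[ℝ] ℝ) :
    pullbackForm E (f ∘ k) x h = pullbackForm E k x (pullbackForm E f (k x) h) := by
  have h1 (u : E) : (mfderiv 𝓘(ℂ, E) 𝓘(ℂ, E) (f ∘ k) x : E →L[ℂ] E) u =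
      (mfderiv 𝓘(ℂ, E) 𝓘(ℂ, E) f (k x) : E →L[ℂ] E)
        ((mfderiv 𝓘(ℂ, E) 𝓘(ℂ, E) k x : E →L[ℂ] E) u) :=
    DFunLike.congr_fun (mfderiv_comp x hf hk) u
  ext u v
  exact congrArg₂ (fun a b : E => h a b) (h1 u) (h1 v)

theorem pullbackForm_bijective {f : N → M} {x : N}
    (hf : (mfderiv 𝓘(ℂ, E) 𝓘(ℂ, E) f x : E →L[ℂ] E).IsInvertible) :
    Function.Bijective (pullbackForm E f x) := by
  obtain ⟨e, he⟩ : ∃ e : E ≃L[ℂ] E, (e : E →L[ℂ] E) = mfderiv 𝓘(ℂ, E) 𝓘(ℂ, E) f x := hf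
  have h1 (h : E →L[ℝ] E →L[ℝ] ℝ) (u v : E) : pullbackForm E f x h u v = h (e u) (e v) := by
    rw [pullbackForm_apply, ← he]; rfl
  refine ⟨fun h h' hh => ?_, fun k => ⟨k.bilinearComp
    ((e.symm : E →L[ℂ] E).restrictScalars ℝ) ((e.symm : E →L[ℂ] E).restrictScalars ℝ), ?_⟩⟩
  · ext u v
    have h2 := DFunLike.congr_fun (DFunLike.congr_fun hh (e.symm u)) (e.symm v)
    simpa [h1] using h2
  · ext u v
    simp [h1]

end Pullback

section LeftInvariant

open Hermitian

variable {E : Type*} [NormedAddCommGroup E] [NormedSpace ℂ E]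
  {G : Type*} [Group G] [TopologicalSpace G] [ChartedSpace E G] [LieGroup 𝓘(ℂ, E) ω G]

theorem HermitianMetric.isHermitianForm_inner {M : Type*} [TopologicalSpace M] [ChartedSpace E M]
    (h : HermitianMetric E M) (x : M) : IsHermitianForm (h.inner x) :=
  ⟨h.symm x, h.pos x, h.hermitian x⟩

omit [LieGroup 𝓘(ℂ, E) ω G] in
theorem HermitianMetric.IsLeftInvariant.inChart_leftFrame {g : HermitianMetric E G}
    (hg : g.IsLeftInvariant) {ε : OpenPartialHomeomorph G E}
    (hε : ε ∈ IsManifold.maximalAtlas 𝓘(ℂ, E) ω G) {y : E} (hy : y ∈ ε.target) (u v : E) :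
    g.inChart ε y (leftFrame ε y u) (leftFrame ε y v) = g.inner 1 u v := by
  have h1 (w : E) : (mfderiv 𝓘(ℂ, E) 𝓘(ℂ, E) ε.symm y : E →L[ℂ] E) (leftFrame ε y w) =
      (mfderiv 𝓘(ℂ, E) 𝓘(ℂ, E) (fun c : G => ε.symm y * c) 1 : E →L[ℂ] E) w := by
    obtain ⟨e, he⟩ : ∃ e : E ≃L[ℂ] E,
        (e : E →L[ℂ] E) = mfderiv 𝓘(ℂ, E) 𝓘(ℂ, E) ε.symm y :=
      isInvertible_mfderiv_chart_symm hε hy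
    have h2 : leftFrame ε y w = e.symm
        ((mfderiv 𝓘(ℂ, E) 𝓘(ℂ, E) (fun c : G => ε.symm y * c) 1 : E →L[ℂ] E) w) := by
      rw [leftFrame, ← he]
      exact DFunLike.congr_fun (ContinuousLinearMap.inverse_equiv e) _
    rw [h2, ← he]
    exact e.apply_symm_apply _
  have h3 := hg (ε.symm y) 1
  rw [mul_one] at h3
  rw [HermitianMetric.inChart, pullbackForm_apply, h1, h1, ← h3]
  rfl

variable [FiniteDimensional ℂ E]

theorem HermitianMetric.IsLeftInvariant.isMaurerCartanAt {g : HermitianMetric E G}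
    (hg : g.IsLeftInvariant) {ε : OpenPartialHomeomorph G E}
    (hε : ε ∈ IsManifold.maximalAtlas 𝓘(ℂ, E) ω G) {y : E} (hy : y ∈ ε.target) :
    IsMaurerCartanAt (g.inChart ε) (g.inner 1) (lieBracketCLM E G) (maurerCartanForm ε) y where
  contDiffAt := contDiffAt_maurerCartanForm hε hy
  isInvertible := isInvertible_maurerCartanForm hε hy
  map_J := Filter.Eventually.of_forall fun z u => by
    rw [J_apply, J_apply]
    exact map_smul (ContinuousLinearMap.inverse (leftFrame ε z)) Complex.I u
  metric := by
    filter_upwards [ε.open_target.mem_nhds hy] with z hz u v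
    rw [← hg.inChart_leftFrame hε hz, leftFrame_maurerCartanForm hε hz,
      leftFrame_maurerCartanForm hε hz]
  maurerCartan := fderiv_maurerCartanForm hε hy

end LeftInvariant

namespace LeftQuotient

variable {E : Type*} [NormedAddCommGroup E] [NormedSpace ℂ E]
  {G : Type*} [Group G] [TopologicalSpace G] [ChartedSpace E G] [LieGroup 𝓘(ℂ, E) ω G]
  {Γ : Subgroup G} [DiscreteTopology Γ]

omit [TopologicalSpace G] [ChartedSpace E G] [LieGroup 𝓘(ℂ, E) ω G] [DiscreteTopology Γ]
  [NormedAddCommGroup E] [NormedSpace ℂ E] in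
theorem exists_proj_eq (x : LeftQuotient Γ) : ∃ a : G, proj Γ a = x :=
  Quotient.exists_rep x

theorem mdifferentiableAt_proj (a : G) :
    MDifferentiableAt 𝓘(ℂ, E) 𝓘(ℂ, E) (proj Γ) a :=
  (isLocalDiffeomorph_proj Γ).contMDiff.contMDiffAt.mdifferentiableAt (by simp)

theorem isInvertible_mfderiv_proj (a : G) :
    (mfderiv 𝓘(ℂ, E) 𝓘(ℂ, E) (proj Γ) a : E →L[ℂ] E).IsInvertible :=
  ⟨(isLocalDiffeomorph_proj Γ).mfderivToContinuousLinearEquiv (by simp) a, rfl⟩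

/-- Every chart of `Γ \ G` lifts locally to a chart of `G`. -/
theorem exists_lift_chart {e : OpenPartialHomeomorph (LeftQuotient Γ) E}
    (he : e ∈ IsManifold.maximalAtlas 𝓘(ℂ, E) ω (LeftQuotient Γ)) {y : E} (hy : y ∈ e.target) :
    ∃ ε ∈ IsManifold.maximalAtlas 𝓘(ℂ, E) ω G, y ∈ ε.target ∧
      ∀ z ∈ ε.target, e.symm z = proj Γ (ε.symm z) := by
  obtain ⟨a, ha⟩ := exists_proj_eq (e.symm y)
  obtain ⟨Φ, haΦ, hΦ⟩ := isLocalDiffeomorph_proj (E := E) Γ a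
  let ψ := Φ.toOpenPartialHomeomorph
  have hψ : ∀ b ∈ ψ.source, proj Γ b = ψ b := hΦ
  -- The lift is `e` preceded by a branch `ψ` of the projection, which is biholomorphic near `a`.
  refine ⟨ψ.trans e, ?_, ?_, fun z hz => ?_⟩
  · apply OpenPartialHomeomorph.mem_maximalAtlas_of_contMDiffOn
    · exact (contMDiffOn_of_mem_maximalAtlas he).comp
        (Φ.contMDiffOn_toFun.mono fun b hb => hb.1) fun b hb => hb.2
    · exact Φ.contMDiffOn_invFun.comp
        ((contMDiffOn_symm_of_mem_maximalAtlas he).mono fun b hb => hb.1) fun b hb => hb.2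
  · refine ⟨hy, ?_⟩
    change e.symm y ∈ ψ.target
    rw [← ha, hψ a haΦ]
    exact ψ.map_source haΦ
  · have hz2 : e.symm z ∈ ψ.target := hz.2
    change e.symm z = proj Γ (ψ.symm (e.symm z))
    rw [hψ _ (ψ.map_target hz2), ψ.right_inv hz2]

theorem pullbackForm_chart_symm {e : OpenPartialHomeomorph (LeftQuotient Γ) E}
    {ε : OpenPartialHomeomorph G E} (hε : ε ∈ IsManifold.maximalAtlas 𝓘(ℂ, E) ω G)
    (h : ∀ z ∈ ε.target, e.symm z = proj Γ (ε.symm z)) {y : E} (hy : y ∈ ε.target)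
    (k : E →L[ℝ] E →L[ℝ] ℝ) :
    pullbackForm E e.symm y k =
      pullbackForm E ε.symm y (pullbackForm E (proj Γ) (ε.symm y) k) := by
  have h1 : e.symm =ᶠ[𝓝 y] proj Γ ∘ ε.symm := by
    filter_upwards [ε.open_target.mem_nhds hy] with z hz using h z hz
  rw [pullbackForm_congr h1, pullbackForm_comp (mdifferentiableAt_proj _)
    ((contMDiffAt_symm_of_mem_maximalAtlas hε hy).mdifferentiableAt (by simp))]

/-- A left invariant metric on `G` descends to a field of bilinear forms on `Γ \ G`. -/
theorem exists_form {g : HermitianMetric E G} (hg : g.IsLeftInvariant) (x : LeftQuotient Γ) :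
    ∃ k : E →L[ℝ] E →L[ℝ] ℝ, ∀ a : G, proj Γ a = x →
      pullbackForm E (proj Γ) a k = g.inner a := by
  obtain ⟨o, ho⟩ := exists_proj_eq x
  obtain ⟨k, hk⟩ := (pullbackForm_bijective (isInvertible_mfderiv_proj (Γ := Γ) o)).2 (g.inner o)
  refine ⟨k, fun a ha => ?_⟩
  -- Two lifts of `x` differ by a left translation from `Γ`, which is an isometry of `g` and
  -- commutes with the projection; hence the form does not depend on the lift.
  obtain ⟨γ, hγ, rfl⟩ : ∃ γ ∈ Γ, a = γ * o :=
    ⟨a * o⁻¹, proj_eq_iff.1 (ho.trans ha.symm), by simp⟩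
  apply (pullbackForm_bijective (isInvertible_mfderiv_mul_left γ o)).1
  rw [hg γ o, ← hk, ← pullbackForm_comp (k := fun c : G => γ * c) (mdifferentiableAt_proj _)
    ((contMDiff_mul_left (I := 𝓘(ℂ, E)) (n := ω)).contMDiffAt.mdifferentiableAt (by simp))]
  congr 1
  ext c
  refine proj_eq_iff.2 ?_
  simpa using hγ

/-- The metric on `Γ \ G` induced by a left invariant metric on `G`. -/
theorem exists_isInducedBy {g : HermitianMetric E G} (hg : g.IsLeftInvariant) :
    ∃ h : HermitianMetric E (LeftQuotient Γ), h.IsInducedBy g := by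
  choose k hk using exists_form (Γ := Γ) hg
  have key (x : LeftQuotient Γ) : ∃ (a : G) (D : E ≃L[ℂ] E),
      ∀ u v, k x u v = g.inner a (D u) (D v) := by
    obtain ⟨a, rfl⟩ := exists_proj_eq x
    obtain ⟨D, hD⟩ : ∃ D : E ≃L[ℂ] E, (D : E →L[ℂ] E) = mfderiv 𝓘(ℂ, E) 𝓘(ℂ, E) (proj Γ) a :=
      isInvertible_mfderiv_proj a
    have h1 (u v : E) : g.inner a u v = k (proj Γ a) (D u) (D v) := by
      rw [← hk _ a rfl, pullbackForm_apply, ← hD]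
      rfl
    refine ⟨a, D.symm, fun u v => ?_⟩
    rw [h1, D.apply_symm_apply, D.apply_symm_apply]
  have hJ (D : E ≃L[ℂ] E) (u : E) : D (Hermitian.J E u) = Hermitian.J E (D u) := by simp
  refine ⟨⟨k, fun x u v => ?_, fun x u hu => ?_, fun x u v => ?_, fun e he y hy => ?_⟩,
    fun a => hk _ a rfl⟩
  · obtain ⟨a, D, hD⟩ := key x
    rw [hD, hD, g.symm]
  · obtain ⟨a, D, hD⟩ := key x
    rw [hD]
    exact g.pos a _ (by simpa using hu)
  · obtain ⟨a, D, hD⟩ := key x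
    rw [hD, hD, hJ, hJ, g.hermitian]
  · obtain ⟨ε, hε, hyε, h⟩ := exists_lift_chart he hy
    refine (((g.smooth ε hε).contDiffAt (ε.open_target.mem_nhds hyε)).congr_of_eventuallyEq
      ?_).contDiffWithinAt
    filter_upwards [ε.open_target.mem_nhds hyε] with z hz
    rw [pullbackForm_chart_symm hε h hz, hk _ _ (h z hz).symm]

end LeftQuotient

namespace HermitianMetric.IsInducedBy

open Hermitian

variable {E : Type*} [NormedAddCommGroup E] [NormedSpace ℂ E]
  {G : Type*} [Group G] [TopologicalSpace G] [ChartedSpace E G] [LieGroup 𝓘(ℂ, E) ω G]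
  {Γ : Subgroup G} [DiscreteTopology Γ] {h h' : HermitianMetric E (LeftQuotient Γ)}
  {g : HermitianMetric E G}

theorem eq (hh : h.IsInducedBy g) (hh' : h'.IsInducedBy g) : h = h' := by
  ext1
  funext x
  obtain ⟨a, rfl⟩ := LeftQuotient.exists_proj_eq x
  exact (pullbackForm_bijective (LeftQuotient.isInvertible_mfderiv_proj a)).1
    ((hh a).trans (hh' a).symm)

theorem inChart_eq (hh : h.IsInducedBy g) {e : OpenPartialHomeomorph (LeftQuotient Γ) E}
    {ε : OpenPartialHomeomorph G E} (hε : ε ∈ IsManifold.maximalAtlas 𝓘(ℂ, E) ω G)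
    (he : ∀ z ∈ ε.target, e.symm z = LeftQuotient.proj Γ (ε.symm z)) {y : E}
    (hy : y ∈ ε.target) : h.inChart e y = g.inChart ε y := by
  rw [inChart, inChart, LeftQuotient.pullbackForm_chart_symm hε he hy, he y hy, hh]

variable [FiniteDimensional ℂ E]

/-- In a lifted chart the induced metric has the same coefficients as `g`, so the Maurer-Cartan form
of `G` serves as a local coframe on the quotient. -/
theorem exists_isMaurerCartanAt (hh : h.IsInducedBy g) (hg : g.IsLeftInvariant)
    {e : OpenPartialHomeomorph (LeftQuotient Γ) E}
    (he : e ∈ IsManifold.maximalAtlas 𝓘(ℂ, E) ω (LeftQuotient Γ)) {y : E} (hy : y ∈ e.target) :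
    ∃ P, ∀ᶠ z in 𝓝 y,
      IsMaurerCartanAt (h.inChart e) (g.inner 1) (lieBracketCLM E G) P z := by
  obtain ⟨ε, hε, hyε, hlift⟩ := LeftQuotient.exists_lift_chart he hy
  refine ⟨maurerCartanForm ε, ?_⟩
  filter_upwards [ε.open_target.mem_nhds hyε] with z hz
  have h1 := hg.isMaurerCartanAt hε hz
  refine ⟨h1.contDiffAt, h1.isInvertible, h1.map_J, ?_, h1.maurerCartan⟩
  filter_upwards [h1.metric, ε.open_target.mem_nhds hz] with w hw hwε
  rwa [hh.inChart_eq hε hlift hwε]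

theorem isBalanced [CompactSpace (LeftQuotient Γ)] (hh : h.IsInducedBy g)
    (hg : g.IsLeftInvariant) : h.IsBalanced := by
  intro e he y hy b hb Y
  have : FiniteDimensional ℝ E := FiniteDimensional.complexToReal E
  obtain ⟨P, hP⟩ := hh.exists_isMaurerCartanAt hg he hy
  exact hP.self_of_nhds.codiffKahler_eq_zero (g.isHermitianForm_inner 1) (by simp) (by simp)
    lieBracketBilin_swap (trace_lieBracketCLM_eq_zero Γ) hb Y

theorem ricciFormVanishes [CompactSpace (LeftQuotient Γ)] (hh : h.IsInducedBy g)
    (hg : g.IsLeftInvariant) (t : ℝ) : h.RicciFormVanishes t := by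
  intro e he y hy b hb X Y
  have : FiniteDimensional ℝ E := FiniteDimensional.complexToReal E
  obtain ⟨P, hP⟩ := hh.exists_isMaurerCartanAt hg he hy
  exact ricciForm_eq_zero hP (g.isHermitianForm_inner 1) (by simp) (by simp)
    lieBracketBilin_swap (trace_lieBracketCLM_eq_zero Γ) t hb X Y

end HermitianMetric.IsInducedBy

end

theorem mainTheorem8 {E : Type*} [NormedAddCommGroup E] [NormedSpace ℂ E] [FiniteDimensional ℂ E]
    {G : Type*} [Group G] [TopologicalSpace G] [ChartedSpace E G] [LieGroup 𝓘(ℂ, E) ω G]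
    (Γ : Subgroup G) [DiscreteTopology Γ] [CompactSpace (LeftQuotient Γ)]
    (g : HermitianMetric E G) (hg : g.IsLeftInvariant) :
    (∃! h : HermitianMetric E (LeftQuotient Γ), h.IsInducedBy g) ∧
      ∀ h : HermitianMetric E (LeftQuotient Γ), h.IsInducedBy g →
        h.IsBalanced ∧ h.IsCYT ∧ ∀ t : ℝ, h.RicciFormVanishes t := by
  obtain ⟨h, hh⟩ := LeftQuotient.exists_isInducedBy (Γ := Γ) hg
  exact ⟨⟨h, hh, fun h' hh' => hh'.eq hh⟩, fun k hk =>
    ⟨hk.isBalanced hg, hk.ricciFormVanishes hg (-1), hk.ricciFormVanishes hg⟩⟩
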